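/- Let $d\in\mathbb{N}$ and $\alpha>0$. Write $\widehat f(\eta)=\int e^{-it\cdot\eta}f(t)\,dt$ and, for $\phi\in\mathcal{S}(\mathbb{R}^d)$ and $(x,\xi)\in\mathbb{R}^d\times(\mathbb{R}^d\setminus\{0\})$, $$\phi_{x,\xi}(t)=|\xi|^{\frac d2(1-\alpha)}\,\phi\big((t-x)|\xi|^{1-\alpha}\big)\,e^{it\cdot\xi}.$$ A lattice $\Omega=\{(x_j^k,\xi_k):k\in\mathbb{N},\,j\in\mathbb{Z}^d\}\subset\mathbb{R}^d\times(\mathbb{R}^d\setminus\{0\})$ is called $\alpha$-admissible if, for some constant $C>0$, the blocks $\{(y,\eta):|y-x_j^k|\le C|\xi_k|^{\alpha-1},\ |\eta-\xi_k|\le C|\xi_k|^{1-\alpha}\}$ cover $\{(x,\xi):|\xi|^\alpha\ge1\}$ and there is an $N_0$ such that every point of $\mathbb{R}^{2d}$ lies in at most $N_0$ of them. A window $\phi\in\mathcal{S}(\mathbb{R}^d)$ is called $\alpha$-admissible if 1. $\widehat\phi$ is supported in an annulus $\{c_1\le|\eta|\le c_2\}$ with $0<c_1<c_2<\infty$; 2.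 the packets are uniformly localized: for every $N\in\mathbb{N}$ there is a $C_N$ such that, for all $x,t,\eta\in\mathbb{R}^d$ and $\xi\ne0$, $$|\phi_{x,\xi}(t)|\le C_N|\xi|^{\frac d2(1-\alpha)}(1+|\xi|^{1-\alpha}|t-x|)^{-N},\qquad |\widehat{\phi_{x,\xi}}(\eta)|\le C_N|\xi|^{-\frac d2(1-\alpha)}(1+|\xi|^{\alpha-1}|\eta-\xi|)^{-N};$$ 3. there is an $\alpha$-admissible lattice $\Omega$ such that $\{\phi_{x_j^k,\xi_k}\}_{(k,j)\in\mathbb{N}\times\mathbb{Z}^d}$ is a frame for $L^2(\mathbb{R}^d)$. For $v\in\mathcal{S}'(\mathbb{R}^d)$ let $V_\phi v(x,\xi)=\langle v,\phi_{x,\xi}\rangle$, where $\langle\cdot,\cdot\rangle$ extends $\int f\,\overline g$. For $u\in\mathcal{S}'(\mathbb{R}^d)$, $x_0\in\mathbb{R}^d$ and $\xi_0\neq0$, say that $u$ is Gabor-microlocally regular of type $\alpha$ at $(x_0,\xi_0)$ with respect to $\phi$ if there exist $\chi\in C_c^\infty(\mathbb{R}^d)$ with $\chi(x_0)\ne0$,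 an open neighbourhood $U$ of $x_0$, an open cone $\Gamma\subset\mathbb{R}^d\setminus\{0\}$ (invariant under dilations $\lambda>0$) containing $\xi_0$, with $|\xi|^\alpha\ge1$ for all sufficiently large $\xi\in\Gamma$, and $R>0$ such that for every $N\in\mathbb{N}$ there is a $C_N$ with $$|V_\phi(\chi u)(x,\xi)|\le C_N(1+|\xi|)^{-N}\qquad\text{for all }x\in U,\ \xi\in\Gamma,\ |\xi|\ge R.$$ Let $WF^{\mathrm G}_{\alpha,\phi}(u)$ be the set of $(x_0,\xi_0)\in\mathbb{R}^d\times(\mathbb{R}^d\setminus\{0\})$ at which $u$ is not Gabor-microlocally regular of type $\alpha$ with respect to $\phi$. **Proposition.** The subdyadic Gabor wavefront set does not depend on the choice of the $\alpha$-admissible window: if $\phi_1,\phi_2$ are $\alpha$-admissible windows, then $WF^{\mathrm G}_{\alpha,\phi_1}(u)=WF^{\mathrm G}_{\alpha,\phi_2}(u)$ for every $u\in\mathcal{S}'(\mathbb{R}^d)$. -/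

import Mathlib

open scoped SchwartzMap FourierTransform ContDiff

noncomputable section

namespace SubdyadicGabor

/-- Euclidean space `ℝ^d`. -/
abbrev Space (d : ℕ) : Type := EuclideanSpace ℝ (Fin d)

/-- The Fourier transform `f ↦ ∫ e^{-i t·η} f(t) dt` (no factor `2π` in the phase), expressed through
Mathlib's transform, which has the phase `e^{-2πi t·η}`; see `fourierHat_eq_integral`. -/
def fourierHat {d : ℕ} (f : 𝓢(Space d, ℂ)) (η : Space d) : ℂ :=
  𝓕 (f : Space d → ℂ) ((2 * Real.pi)⁻¹ • η)

theorem fourierHat_eq_integral {d : ℕ} (f : 𝓢(Space d, ℂ)) (η : Space d) :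
    fourierHat f η = ∫ t, Complex.exp (-(Complex.I * (inner ℝ t η : ℝ))) * f t := by
  unfold fourierHat
  rw [Real.fourier_eq']
  refine MeasureTheory.integral_congr_ae (Filter.Eventually.of_forall fun t => ?_)
  have hpi : (Real.pi : ℂ) ≠ 0 := by exact_mod_cast Real.pi_ne_zero
  simp only [smul_eq_mul, inner_smul_right]
  congr 2
  push_cast
  field_simp

/-- Complex conjugation of Schwartz functions. -/
def conjSchwartz {d : ℕ} (f : 𝓢(Space d, ℂ)) : 𝓢(Space d, ℂ) :=
  SchwartzMap.postcompCLM (𝕜 := ℝ) (Complex.conjCLE : ℂ →L[ℝ] ℂ) f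

@[simp]
theorem conjSchwartz_apply {d : ℕ} (f : 𝓢(Space d, ℂ)) (t : Space d) :
    conjSchwartz f t = (starRingEnd ℂ) (f t) := rfl

theorem hasTemperateGrowth_modulation {d : ℕ} (ξ : Space d) :
    Function.HasTemperateGrowth
      (fun t : Space d => Complex.exp (Complex.I * (inner ℝ t ξ : ℝ))) := by
  have key : ∀ n : ℕ, iteratedDeriv n (fun s : ℝ => Complex.exp (Complex.I * s)) =
      fun s : ℝ => Complex.I ^ n * Complex.exp (Complex.I * s) := by
    intro n
    induction n with
    | zero => simp
    | succ n ih =>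
      rw [iteratedDeriv_succ, ih]
      funext s
      have h1 : HasDerivAt (fun s : ℝ => Complex.I * (s : ℂ)) (Complex.I * 1) s :=
        (Complex.ofRealCLM.hasDerivAt (x := s)).const_mul Complex.I
      have h2 := (h1.cexp).const_mul (Complex.I ^ n)
      rw [h2.deriv]
      ring
  have hexp : Function.HasTemperateGrowth (fun s : ℝ => Complex.exp (Complex.I * s)) := by
    refine ⟨?_, fun n => ⟨0, 1, fun s => ?_⟩⟩
    · exact (contDiff_const.mul Complex.ofRealCLM.contDiff).cexp
    · rw [norm_iteratedFDeriv_eq_norm_iteratedDeriv, key]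
      simp [Complex.norm_exp]
  have hin : Function.HasTemperateGrowth (fun t : Space d => (inner ℝ t ξ : ℝ)) := by
    have h := (innerSL ℝ ξ).hasTemperateGrowth
    have h' : (fun t : Space d => (inner ℝ t ξ : ℝ)) = fun t => innerSL ℝ ξ t := by
      funext t
      simp [real_inner_comm]
    rw [h']
    exact h
  exact hexp.comp hin

/-- The dispersive wave packet
`φ_{x,ξ}(t) = |ξ|^{(d/2)(1-α)} φ((t - x)|ξ|^{1-α}) e^{i t·ξ}` for `ξ ≠ 0`, as a Schwartz function
(see `packet_apply`); the value at `ξ = 0` is a placeholder that is never used. -/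
def packet {d : ℕ} (α : ℝ) (φ : 𝓢(Space d, ℂ)) (x ξ : Space d) : 𝓢(Space d, ℂ) :=
  if hξ : ξ = 0 then 0
  else
    ((‖ξ‖ ^ ((d : ℝ) / 2 * (1 - α)) : ℝ) : ℂ) •
      SchwartzMap.smulLeftCLM ℂ (fun t : Space d => Complex.exp (Complex.I * (inner ℝ t ξ : ℝ)))
        (SchwartzMap.compSubConstCLM ℂ x
          (SchwartzMap.compCLMOfContinuousLinearEquiv ℂ
            (ContinuousLinearEquiv.smulLeft (R₁ := ℝ) (M₁ := Space d)
              (Units.mk0 (‖ξ‖ ^ (1 - α))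
                (Real.rpow_pos_of_pos (norm_pos_iff.mpr hξ) (1 - α)).ne')) φ))

theorem packet_apply {d : ℕ} (α : ℝ) (φ : 𝓢(Space d, ℂ)) (x : Space d) {ξ : Space d}
    (hξ : ξ ≠ 0) (t : Space d) :
    packet α φ x ξ t =
      ((‖ξ‖ ^ ((d : ℝ) / 2 * (1 - α)) : ℝ) : ℂ) * φ (‖ξ‖ ^ (1 - α) • (t - x)) *
        Complex.exp (Complex.I * (inner ℝ t ξ : ℝ)) := by
  unfold packet
  rw [dif_neg hξ]
  simp only [smul_apply, SchwartzMap.smulLeftCLM_apply_apply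
    (hasTemperateGrowth_modulation ξ), smul_eq_mul]
  rw [mul_assoc, mul_comm (Complex.exp _)]
  rfl

/-- The dispersive short-time Fourier transform `V_φ v(x,ξ) = ⟨v, φ_{x,ξ}⟩` of a tempered
distribution, where the pairing is antilinear in the second argument, so that
`V_φ v(x,ξ) = ∫ v(t) conj(φ_{x,ξ}(t)) dt` for functions `v`. -/
def dispersiveSTFT {d : ℕ} (α : ℝ) (φ : 𝓢(Space d, ℂ)) (v : 𝓢'(Space d, ℂ))
    (x ξ : Space d) : ℂ :=
  v (conjSchwartz (packet α φ x ξ))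

/-- Cut-offs have temperate growth, so that multiplying a tempered distribution by one of them
through `TemperedDistribution.smulLeftCLM` is the usual product. -/
theorem hasTemperateGrowth_cutoff {d : ℕ} {χ : Space d → ℂ} (h₁ : ContDiff ℝ ∞ χ)
    (h₂ : HasCompactSupport χ) : Function.HasTemperateGrowth χ :=
  (h₂.toSchwartzMap h₁).hasTemperateGrowth

/-- The subdyadic block `Q_α(x,ξ;ρ)` with fixed geometric constant `C`. -/
def block {d : ℕ} (α C ρ : ℝ) (x ξ : Space d) : Set (Space d × Space d) :=
  {p | ‖p.1 - x‖ ≤ C * ρ * ‖ξ‖ ^ (α - 1) ∧ ‖p.2 - ξ‖ ≤ C * ρ * ‖ξ‖ ^ (1 - α)}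

/-- `α`-admissibility of a lattice `{(x_j^k, ξ_k) : k ∈ ℕ, j ∈ ℤ^d}`: the unit blocks cover
`{|ξ|^α ≥ 1}`, and every point of phase space lies in at most `N₀` of them. -/
def IsAdmissibleLattice {d : ℕ} (α : ℝ) (xs : ℕ → (Fin d → ℤ) → Space d)
    (ξs : ℕ → Space d) : Prop :=
  (∀ k, ξs k ≠ 0) ∧
  ∃ C : ℝ, 0 < C ∧
    (∀ x ξ : Space d, 1 ≤ ‖ξ‖ ^ α → ∃ k j, (x, ξ) ∈ block α C 1 (xs k j) (ξs k)) ∧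
    ∃ N₀ : ℕ, ∀ p : Space d × Space d,
      {i : ℕ × (Fin d → ℤ) | p ∈ block α C 1 (xs i.1 i.2) (ξs i.1)}.encard ≤ N₀

/-- The frame property of a family in a Hilbert space. -/
def IsFrame {ι H : Type*} [NormedAddCommGroup H] [InnerProductSpace ℂ H] (e : ι → H) : Prop :=
  ∃ A B : ℝ, 0 < A ∧ ∀ f : H,
    Summable (fun i => ‖inner ℂ (e i) f‖ ^ 2) ∧
    A * ‖f‖ ^ 2 ≤ ∑' i, ‖inner ℂ (e i) f‖ ^ 2 ∧
    ∑' i, ‖inner ℂ (e i) f‖ ^ 2 ≤ B * ‖f‖ ^ 2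

/-- Uniform localization of the packets in the blocks `Q_α(x,ξ;1)`: `φ_{x,ξ}` decays rapidly away
from `x` at the scale `|ξ|^{α-1}`, and its Fourier transform decays rapidly away from `ξ` at the
scale `|ξ|^{1-α}`, with constants that do not depend on `(x,ξ)` (the prefactors are those of the
`L²`-normalization at these scales). -/
def PacketsUniformlyLocalized {d : ℕ} (α : ℝ) (φ : 𝓢(Space d, ℂ)) : Prop :=
  ∀ N : ℕ, ∃ C : ℝ, ∀ x ξ : Space d, ξ ≠ 0 →
    (∀ t : Space d, ‖packet α φ x ξ t‖ ≤
      C * ‖ξ‖ ^ ((d : ℝ) / 2 * (1 - α)) * ((1 + ‖ξ‖ ^ (1 - α) * ‖t - x‖) ^ N)⁻¹) ∧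
    (∀ η : Space d, ‖fourierHat (packet α φ x ξ) η‖ ≤
      C * ‖ξ‖ ^ ((d : ℝ) / 2 * (α - 1)) * ((1 + ‖ξ‖ ^ (α - 1) * ‖η - ξ‖) ^ N)⁻¹)

/-- `α`-admissible windows. -/
structure IsAdmissibleWindow {d : ℕ} (α : ℝ) (φ : 𝓢(Space d, ℂ)) : Prop where
  fourier_support : ∃ c₁ c₂ : ℝ, 0 < c₁ ∧ c₁ < c₂ ∧
    ∀ η : Space d, fourierHat φ η ≠ 0 → c₁ ≤ ‖η‖ ∧ ‖η‖ ≤ c₂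
  localized : PacketsUniformlyLocalized α φ
  frame : ∃ (xs : ℕ → (Fin d → ℤ) → Space d) (ξs : ℕ → Space d),
    IsAdmissibleLattice α xs ξs ∧
    IsFrame (fun i : ℕ × (Fin d → ℤ) => (packet α φ (xs i.1 i.2) (ξs i.1)).toLp 2)

/-- Open cones in `ℝ^d ∖ {0}`. -/
structure IsOpenCone {d : ℕ} (Γ : Set (Space d)) : Prop where
  isOpen : IsOpen Γ
  ne_zero : ∀ ξ ∈ Γ, ξ ≠ 0
  smul_mem : ∀ ξ ∈ Γ, ∀ s : ℝ, 0 < s → s • ξ ∈ Γ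

/-- Gabor-microlocal regularity of type `α` of `u` at `(x₀, ξ₀)`, `ξ₀ ≠ 0`, tested with the
window `φ`. -/
def IsGaborRegularAt {d : ℕ} (α : ℝ) (φ : 𝓢(Space d, ℂ)) (u : 𝓢'(Space d, ℂ))
    (x₀ ξ₀ : Space d) : Prop :=
  ∃ (χ : Space d → ℂ) (U Γ : Set (Space d)) (R : ℝ),
    ContDiff ℝ ∞ χ ∧ HasCompactSupport χ ∧ χ x₀ ≠ 0 ∧
    IsOpen U ∧ x₀ ∈ U ∧
    IsOpenCone Γ ∧ ξ₀ ∈ Γ ∧ (∃ R₀ : ℝ, ∀ ξ ∈ Γ, R₀ ≤ ‖ξ‖ → 1 ≤ ‖ξ‖ ^ α) ∧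
    0 < R ∧
    ∀ N : ℕ, ∃ C : ℝ, ∀ x ∈ U, ∀ ξ ∈ Γ, R ≤ ‖ξ‖ →
      ‖dispersiveSTFT α φ (TemperedDistribution.smulLeftCLM ℂ χ u) x ξ‖ ≤
        C * ((1 + ‖ξ‖) ^ N)⁻¹

/-- The subdyadic Gabor wavefront set of `u`, computed with the window `φ`, as a subset of
`ℝ^d × (ℝ^d ∖ {0})`. -/
def gaborWF {d : ℕ} (α : ℝ) (φ : 𝓢(Space d, ℂ)) (u : 𝓢'(Space d, ℂ)) :
    Set (Space d × Space d) :=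
  {p | p.2 ≠ 0 ∧ ¬ IsGaborRegularAt α φ u p.1 p.2}

end SubdyadicGabor

end

noncomputable section

namespace SubdyadicGabor

/-! ### Taylor remainders of the exponential -/

/-! For a nonzero admissible window, Gabor regularity at a point is equivalent to classical
microlocal regularity in Hörmander's sense (`isGaborRegularAt_iff_isMicrolocallyRegularAt`), which
does not mention the window. Two nonzero windows therefore have the same wavefront set. The zero
window violates the lower frame bound unless the Schwartz space is trivial, in which case the two
windows coincide.

For a cut-off `Θ`, let F = `freq u Θ` be the Fourier transform of `Θ u`, a continuous function of
polynomial growth. Up to the factor |ξ|^{(d/2)(1-α)}, which is polynomially harmless in both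
directions, the modulus of the short-time transform is that of the average ∫ ψ(s) e^{iμ⟨x,s⟩} F(ξ +
μs) ds (`averagedFreq`), with μ = 2π|ξ|^{1-α} and ψ the conjugate Fourier transform of the window.
By admissibility ψ has compact support. As α > 0, the displacement μs is o(|ξ|) on that support, so
the average only sees a slightly larger cone: classical regularity implies Gabor regularity.

The converse is a deconvolution, and depends on the size of μ.

If α = 1, then μ is constant and the average at x is the Fourier transform of `Θ u` times the
conjugate of φ(· - x). A band-limited φ ≠ 0 vanishes on no open set, so some x ∈ U gives a factor
that is nonzero at x₀. Dividing by it near x₀ is a convolution in frequency with a Schwartz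
function, which preserves rapid decay in smaller cones.

If α < 1, then μ → ∞ and the packets shrink. Integrating the averages over x near x₀ produces a
kernel in s concentrated at scale |ξ|^{α-1} around a point w with ψ(w) ≠ 0. Up to rapidly decaying
tails, this is the Fourier transform of a smaller cut-off of u at ξ + μw, and such points fill a
smaller cone.

If α > 1, then μ → 0 and the packets spread. Integrating by parts in x against a test function g
supported in U inserts an arbitrary polynomial weight P(s) at polynomial cost. Choosing P so that ∫
ψPQ = Q(0) for all Q of bounded degree, and Taylor expanding to high order, isolates F(ξ)∫g up to an
error containing an arbitrarily high power of μ. -/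

/-- The remainder of order `M` in the Taylor expansion of `exp (-iθ)`. -/
def expRemainder (M : ℕ) (θ : ℝ) : ℂ :=
  Complex.exp (-(Complex.I * θ)) -
    ∑ k ∈ Finset.range M, (-(Complex.I * θ)) ^ k / (k.factorial : ℂ)

theorem contDiff_expRemainder (M : ℕ) : ContDiff ℝ ∞ (expRemainder M) := by
  unfold expRemainder
  have h : ContDiff ℝ ∞ (fun θ : ℝ => -(Complex.I * (θ : ℂ))) :=
    (contDiff_const.mul Complex.ofRealCLM.contDiff).neg
  exact h.cexp.sub (ContDiff.sum fun k _ => (h.pow k).div_const _)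

/-- Truncated subtraction matters: at `M = 0` the remainder is the exponential itself, which
differentiation reproduces, so one formula serves all orders. -/
theorem hasDerivAt_expRemainder (M : ℕ) (θ : ℝ) :
    HasDerivAt (expRemainder M) (-Complex.I * expRemainder (M - 1) θ) θ := by
  have h : HasDerivAt (fun θ : ℝ => -(Complex.I * (θ : ℂ))) (-(Complex.I * 1)) θ :=
    ((Complex.ofRealCLM.hasDerivAt (x := θ)).const_mul Complex.I).neg
  rcases M with - | M
  · have := h.cexp
    unfold expRemainder
    simp only [Finset.range_zero, Finset.sum_empty, sub_zero]
    convert this using 1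
    ring
  · unfold expRemainder
    have h1 := h.cexp
    have h2 : HasDerivAt (fun θ : ℝ => ∑ k ∈ Finset.range (M + 1),
        (-(Complex.I * (θ : ℂ))) ^ k / (k.factorial : ℂ))
        (∑ k ∈ Finset.range (M + 1),
          ((k : ℂ) * (-(Complex.I * (θ : ℂ))) ^ (k - 1) * (-(Complex.I * 1))) / (k.factorial : ℂ))
        θ := by
      have := HasDerivAt.fun_sum (u := Finset.range (M + 1)) (x := θ) fun k _ =>
        (h.fun_pow k).div_const (k.factorial : ℂ)
      exact this
    refine (h1.sub h2).congr_deriv ?_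
    symm
    rw [Finset.sum_range_succ', Nat.add_sub_cancel]
    simp only [Nat.cast_zero, zero_mul, zero_div, add_zero, Nat.add_sub_cancel]
    rw [mul_sub, Finset.mul_sum]
    congr 1
    · ring
    · refine Finset.sum_congr rfl fun k _ => ?_
      rw [Nat.factorial_succ]
      have : (k.factorial : ℂ) ≠ 0 := by exact_mod_cast k.factorial_ne_zero
      have : (k : ℂ) + 1 ≠ 0 := by exact_mod_cast k.succ_ne_zero
      push_cast
      field_simp

theorem iteratedDeriv_expRemainder (j M : ℕ) :
    iteratedDeriv j (expRemainder M) = fun θ => (-Complex.I) ^ j * expRemainder (M - j) θ := by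
  induction j with
  | zero => simp
  | succ j ih =>
    rw [iteratedDeriv_succ, ih]
    funext θ
    rw [((hasDerivAt_expRemainder (M - j) θ).const_mul _).deriv, Nat.sub_sub]
    ring

/-- Mean value inequality and induction on the order. The phase is imaginary, so the bound is global
in `θ` and has no exponential factor. -/
theorem norm_expRemainder_le (M : ℕ) (θ : ℝ) : ‖expRemainder M θ‖ ≤ |θ| ^ M := by
  induction M generalizing θ with
  | zero => simp [expRemainder, Complex.norm_exp]
  | succ M ih =>
    have h0 : expRemainder (M + 1) 0 = 0 := by
      simp [expRemainder, Finset.sum_range_succ']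
    have := Convex.norm_image_sub_le_of_norm_hasDerivWithin_le (f := expRemainder (M + 1))
      (s := Set.uIcc 0 θ) (x := 0) (y := θ) (C := |θ| ^ M)
      (fun t _ => (hasDerivAt_expRemainder (M + 1) t).hasDerivWithinAt)
      (fun t ht => by
        rw [norm_mul, norm_neg, Complex.norm_I, one_mul]
        refine (ih t).trans ?_
        have : |t| ≤ |θ| := by simpa using Set.abs_sub_left_of_mem_uIcc ht
        gcongr)
      (convex_uIcc 0 θ) Set.left_mem_uIcc Set.right_mem_uIcc
    rw [h0, sub_zero, sub_zero, Real.norm_eq_abs] at this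
    rwa [pow_succ]

/-- A majorant independent of `M`, for dominated convergence as `M → ∞`. -/
theorem norm_expRemainder_le_exp (M : ℕ) (θ : ℝ) : ‖expRemainder M θ‖ ≤ Real.exp |θ| := by
  have h := Complex.norm_exp_sub_sum_le_exp_norm_sub_sum (-(Complex.I * (θ : ℂ))) M
  refine h.trans ?_
  have : ‖-(Complex.I * (θ : ℂ))‖ = |θ| := by simp
  rw [this]
  have : 0 ≤ ∑ m ∈ Finset.range M, |θ| ^ m / (m.factorial : ℝ) :=
    Finset.sum_nonneg fun _ _ => by positivity
  linarith

theorem tendsto_expRemainder (θ : ℝ) :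
    Filter.Tendsto (fun M => expRemainder M θ) Filter.atTop (nhds 0) := by
  have h : HasSum (fun k : ℕ => (-(Complex.I * (θ : ℂ))) ^ k / (k.factorial : ℂ))
      (Complex.exp (-(Complex.I * (θ : ℂ)))) := by
    rw [Complex.exp_eq_exp_ℂ]
    exact NormedSpace.expSeries_div_hasSum_exp _
  have := h.tendsto_sum_nat.const_sub (Complex.exp (-(Complex.I * (θ : ℂ))))
  simpa [expRemainder] using this

variable {d : ℕ}

/-- The remainder of order `M` of `t ↦ exp (-i⟨t, y⟩)`. -/
def oscRemainder (M : ℕ) (y t : Space d) : ℂ := expRemainder M (inner ℝ t y)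

theorem norm_iteratedFDeriv_oscRemainder_le (j M : ℕ) (y t : Space d) :
    ‖iteratedFDeriv ℝ j (oscRemainder M y) t‖ ≤ ‖y‖ ^ j * (‖t‖ * ‖y‖) ^ (M - j) := by
  have hfun : oscRemainder M y = expRemainder M ∘ (innerSL ℝ y) := by
    funext t
    simp [oscRemainder, real_inner_comm]
  rw [hfun, ContinuousLinearMap.iteratedFDeriv_comp_right (n := ∞) _ (contDiff_expRemainder M) _
    (by exact_mod_cast le_top)]
  refine (ContinuousMultilinearMap.norm_compContinuousLinearMap_le _ _).trans ?_
  rw [norm_iteratedFDeriv_eq_norm_iteratedDeriv, iteratedDeriv_expRemainder]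
  simp only [norm_mul, norm_pow, norm_neg, Complex.norm_I, one_pow, one_mul, Finset.prod_const,
    Finset.card_univ, Fintype.card_fin, innerSL_apply_norm, innerSL_apply_apply]
  rw [mul_comm]
  gcongr
  refine (norm_expRemainder_le _ _).trans ?_
  gcongr
  rw [mul_comm]
  exact abs_real_inner_le_norm y t

theorem contDiff_oscRemainder (M : ℕ) (y : Space d) : ContDiff ℝ ∞ (oscRemainder M y) :=
  (contDiff_expRemainder M).comp (contDiff_id.inner ℝ contDiff_const)

/-- All derivatives of order at most `n` are put into one form, polynomial in `t`, that keeps the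
full power `‖y‖ ^ M`. That power is the gain in the Taylor estimates. -/
theorem norm_iteratedFDeriv_oscRemainder_le' {j n : ℕ} (hj : j ≤ n) (M : ℕ) (y t : Space d) :
    ‖iteratedFDeriv ℝ j (oscRemainder M y) t‖ ≤
      (‖y‖ ^ M * (1 + ‖y‖) ^ n) * (1 + ‖t‖) ^ M := by
  refine (norm_iteratedFDeriv_oscRemainder_le j M y t).trans ?_
  rw [mul_pow, mul_left_comm, ← pow_add, mul_comm]
  gcongr
  · rcases le_total j M with h | h
    · rw [Nat.add_sub_cancel' h]
      exact le_mul_of_one_le_right (by positivity) (one_le_pow₀ (by simp))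
    · rw [Nat.sub_eq_zero_of_le h, add_zero]
      obtain ⟨k, rfl⟩ := Nat.exists_eq_add_of_le h
      rw [pow_add]
      gcongr
      calc ‖y‖ ^ k ≤ (1 + ‖y‖) ^ k := by gcongr; simp
        _ ≤ (1 + ‖y‖) ^ n := pow_le_pow_right₀ (by simp) (by omega)
  · calc ‖t‖ ^ (M - j) ≤ (1 + ‖t‖) ^ (M - j) := by gcongr; simp
      _ ≤ (1 + ‖t‖) ^ M := pow_le_pow_right₀ (by simp) (Nat.sub_le _ _)

theorem hasTemperateGrowth_oscRemainder (M : ℕ) (y : Space d) :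
    Function.HasTemperateGrowth (oscRemainder M y) :=
  ⟨contDiff_oscRemainder M y, fun _ =>
    ⟨M, _, fun t => norm_iteratedFDeriv_oscRemainder_le' le_rfl M y t⟩⟩

/-- The oscillation `t ↦ exp (-i⟨t, η⟩)`. -/
def osc (η t : Space d) : ℂ := Complex.exp (-(Complex.I * (inner ℝ t η : ℝ)))

theorem oscRemainder_zero (y : Space d) : oscRemainder 0 y = osc y := by
  funext t
  simp [oscRemainder, osc, expRemainder]

theorem hasTemperateGrowth_osc (η : Space d) : Function.HasTemperateGrowth (osc η) :=
  oscRemainder_zero η ▸ hasTemperateGrowth_oscRemainder 0 η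

@[simp] theorem norm_osc (η t : Space d) : ‖osc η t‖ = 1 := by
  simp [osc, Complex.norm_exp]

theorem osc_add (η y t : Space d) : osc (η + y) t = osc η t * osc y t := by
  simp only [osc, inner_add_right, ← Complex.exp_add]
  congr 1
  push_cast
  ring

/-! ### Seminorms and functionals on the Schwartz space -/

variable {E : Type*} [NormedAddCommGroup E] [NormedSpace ℝ E]

/-- The supremum of the Schwartz seminorms of order at most `K` in both indices. -/
def supSeminorm (E : Type*) [NormedAddCommGroup E] [NormedSpace ℝ E] (K : ℕ) : Seminorm ℂ 𝓢(E, ℂ) :=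
  (Finset.Iic ((K, K) : ℕ × ℕ)).sup (schwartzSeminormFamily ℂ E ℂ)

theorem seminorm_le_supSeminorm {K k n : ℕ} (hk : k ≤ K) (hn : n ≤ K) (f : 𝓢(E, ℂ)) :
    SchwartzMap.seminorm ℂ k n f ≤ supSeminorm E K f :=
  Seminorm.le_def.1 (Finset.le_sup (f := schwartzSeminormFamily ℂ E ℂ)
    (Finset.mem_Iic.2 (Prod.mk_le_mk.2 ⟨hk, hn⟩) : ((k, n) : ℕ × ℕ) ∈ Finset.Iic (K, K))) f

theorem supSeminorm_le_of {K : ℕ} {f : 𝓢(E, ℂ)} {B : ℝ} (hB : 0 ≤ B)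
    (h : ∀ k ≤ K, ∀ n ≤ K, SchwartzMap.seminorm ℂ k n f ≤ B) : supSeminorm E K f ≤ B := by
  refine Seminorm.finset_sup_apply_le hB fun i hi => ?_
  obtain ⟨h1, h2⟩ := Prod.mk_le_mk.1 (Finset.mem_Iic.1 hi)
  exact h _ h1 _ h2

theorem pow_mul_norm_iteratedFDeriv_le_supSeminorm {K k n : ℕ} (hk : k ≤ K) (hn : n ≤ K)
    (f : 𝓢(E, ℂ)) (t : E) :
    (1 + ‖t‖) ^ k * ‖iteratedFDeriv ℝ n f t‖ ≤ 2 ^ K * supSeminorm E K f :=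
  SchwartzMap.one_add_le_sup_seminorm_apply (𝕜 := ℂ) (m := (K, K)) hk hn f t

/-- Leibniz rule; the growth of the multiplier is absorbed by `m` extra weights. The bound is linear
in `A`, so the dependence of a multiplier on parameters stays explicit. -/
theorem supSeminorm_smulLeftCLM_le {a : E → ℂ} (ha : Function.HasTemperateGrowth a)
    {K m : ℕ} {A : ℝ} (hA : ∀ j ≤ K, ∀ t, ‖iteratedFDeriv ℝ j a t‖ ≤ A * (1 + ‖t‖) ^ m)
    (f : 𝓢(E, ℂ)) :
    supSeminorm E K (SchwartzMap.smulLeftCLM ℂ a f) ≤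
      A * (2 ^ K * 2 ^ (K + m) * supSeminorm E (K + m) f) := by
  have hA0 : 0 ≤ A := by
    have := (norm_nonneg _).trans (hA 0 (Nat.zero_le _) 0)
    simpa using this
  refine supSeminorm_le_of (by positivity) fun k hk n hn => ?_
  refine SchwartzMap.seminorm_le_bound ℂ k n _ (by positivity) fun t => ?_
  have hfun : (SchwartzMap.smulLeftCLM ℂ a f : E → ℂ) = fun t => a t * f t := by
    funext t
    simp [SchwartzMap.smulLeftCLM_apply_apply ha]
  rw [hfun]
  have hle := norm_iteratedFDeriv_mul_le (𝕜 := ℝ) (N := ∞) ha.1 (f.smooth ⊤) t (n := n)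
    (by exact_mod_cast le_top)
  have hterm : ∀ i ∈ Finset.range (n + 1),
      ‖t‖ ^ k * ((n.choose i : ℝ) * ‖iteratedFDeriv ℝ i a t‖ * ‖iteratedFDeriv ℝ (n - i) f t‖) ≤
        (n.choose i : ℝ) * (A * (2 ^ (K + m) * supSeminorm E (K + m) f)) := by
    intro i hi
    have hi' : i ≤ K := (Finset.mem_range_succ_iff.1 hi).trans hn
    have h1 := hA i hi' t
    have h2 := pow_mul_norm_iteratedFDeriv_le_supSeminorm (K := K + m) (k := k + m) (n := n - i)
      (by omega) (by omega) f t
    calc ‖t‖ ^ k * ((n.choose i : ℝ) * ‖iteratedFDeriv ℝ i a t‖ * ‖iteratedFDeriv ℝ (n - i) f t‖)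
        ≤ (1 + ‖t‖) ^ k * ((n.choose i : ℝ) * (A * (1 + ‖t‖) ^ m) *
            ‖iteratedFDeriv ℝ (n - i) f t‖) := by
          gcongr
          simp
      _ = (n.choose i : ℝ) * (A * ((1 + ‖t‖) ^ (k + m) * ‖iteratedFDeriv ℝ (n - i) f t‖)) := by
          rw [pow_add]; ring
      _ ≤ _ := by gcongr
  calc ‖t‖ ^ k * ‖iteratedFDeriv ℝ n (fun t => a t * f t) t‖
      ≤ ∑ i ∈ Finset.range (n + 1), ‖t‖ ^ k *
          ((n.choose i : ℝ) * ‖iteratedFDeriv ℝ i a t‖ * ‖iteratedFDeriv ℝ (n - i) f t‖) := by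
        rw [← Finset.mul_sum]
        gcongr
    _ ≤ ∑ i ∈ Finset.range (n + 1),
          (n.choose i : ℝ) * (A * (2 ^ (K + m) * supSeminorm E (K + m) f)) :=
        Finset.sum_le_sum hterm
    _ = 2 ^ n * (A * (2 ^ (K + m) * supSeminorm E (K + m) f)) := by
        rw [← Finset.sum_mul]
        congr 1
        exact_mod_cast Nat.sum_range_choose n
    _ ≤ 2 ^ K * (A * (2 ^ (K + m) * supSeminorm E (K + m) f)) := by
        gcongr
        norm_num
    _ = _ := by ring

theorem continuous_supSeminorm (K : ℕ) : Continuous (supSeminorm E K) := by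
  refine Finset.sup_induction (p := fun q : Seminorm ℂ 𝓢(E, ℂ) => Continuous q)
    continuous_const (fun p hp q hq => hp.max hq) fun i _ => ?_
  exact (schwartz_withSeminorms ℂ E ℂ).continuous_seminorm i

theorem exists_seminorm_le_supSeminorm (q : Seminorm ℂ 𝓢(E, ℂ)) (hq : Continuous q) :
    ∃ (C : ℝ) (K : ℕ), 0 ≤ C ∧ ∀ f, q f ≤ C * supSeminorm E K f := by
  obtain ⟨s, C, -, hC⟩ := Seminorm.bound_of_continuous (schwartz_withSeminorms ℂ E ℂ) q hq
  refine ⟨C, s.sup Prod.fst + s.sup Prod.snd, C.2, fun f => (hC f).trans ?_⟩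
  rw [_root_.smul_apply, NNReal.smul_def, smul_eq_mul]
  refine mul_le_mul_of_nonneg_left ?_ C.2
  refine Seminorm.finset_sup_apply_le (apply_nonneg _ _) fun i hi => ?_
  exact seminorm_le_supSeminorm
    ((Finset.le_sup (f := Prod.fst) hi).trans (Nat.le_add_right _ _))
    ((Finset.le_sup (f := Prod.snd) hi).trans (Nat.le_add_left _ _)) f

theorem exists_norm_apply_le_supSeminorm (u : 𝓢(E, ℂ) →L[ℂ] ℂ) :
    ∃ (C : ℝ) (K : ℕ), 0 ≤ C ∧ ∀ f, ‖u f‖ ≤ C * supSeminorm E K f :=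
  exists_seminorm_le_supSeminorm ((normSeminorm ℂ ℂ).comp u.toLinearMap)
    (by exact u.continuous.norm)

theorem exists_supSeminorm_apply_le (T : 𝓢(E, ℂ) →L[ℂ] 𝓢(E, ℂ)) (K : ℕ) :
    ∃ (C : ℝ) (L : ℕ), 0 ≤ C ∧ ∀ f, supSeminorm E K (T f) ≤ C * supSeminorm E L f :=
  exists_seminorm_le_supSeminorm ((supSeminorm E K).comp T.toLinearMap)
    (by exact (continuous_supSeminorm K).comp T.continuous)

/-- Indices for the values of the weighted directional derivatives of order at most `K`. -/
structure JetIndex (E : Type*) [NormedAddCommGroup E] (K : ℕ) where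
  /-- the exponent of the weight -/
  weight : ℕ
  weight_le : weight ≤ K
  /-- the order of the derivative -/
  order : ℕ
  order_le : order ≤ K
  /-- the base point -/
  point : E
  /-- the directions -/
  dir : Fin order → E
  norm_dir_le : ∀ i, ‖dir i‖ ≤ 1

instance (E : Type*) [NormedAddCommGroup E] (K : ℕ) : TopologicalSpace (JetIndex E K) := ⊥

instance (E : Type*) [NormedAddCommGroup E] (K : ℕ) : DiscreteTopology (JetIndex E K) := ⟨rfl⟩

theorem norm_jet_le_aux {K : ℕ} (f : 𝓢(E, ℂ)) (i : JetIndex E K) :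
    ‖((‖i.point‖ ^ i.weight : ℝ) : ℂ) * iteratedFDeriv ℝ i.order f i.point i.dir‖ ≤
      supSeminorm E K f := by
  refine le_trans ?_ ((SchwartzMap.le_seminorm ℂ i.weight i.order f i.point).trans
    (seminorm_le_supSeminorm i.weight_le i.order_le f))
  rw [norm_mul, Complex.norm_real, norm_pow, norm_norm]
  gcongr
  refine (ContinuousMultilinearMap.le_opNorm _ _).trans ?_
  exact mul_le_of_le_one_right (norm_nonneg _)
    (Finset.prod_le_one (fun _ _ => norm_nonneg _) fun j _ => i.norm_dir_le j)

/-- The values of the weighted directional derivatives of order at most `K`, as a bounded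
function. -/
def jet (E : Type*) [NormedAddCommGroup E] [NormedSpace ℝ E] (K : ℕ) :
    𝓢(E, ℂ) →L[ℂ] BoundedContinuousFunction (JetIndex E K) ℂ :=
  SchwartzMap.mkCLMtoNormedSpace
    (fun f => BoundedContinuousFunction.ofNormedAddCommGroup
      (fun i : JetIndex E K =>
        ((‖i.point‖ ^ i.weight : ℝ) : ℂ) * iteratedFDeriv ℝ i.order f i.point i.dir)
      continuous_of_discreteTopology (supSeminorm E K f) (norm_jet_le_aux f))
    (fun f g => by
      ext i
      simp only [BoundedContinuousFunction.coe_ofNormedAddCommGroup,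
        BoundedContinuousFunction.coe_add, Pi.add_apply]
      rw [show ((f + g : 𝓢(E, ℂ)) : E → ℂ) = f + g from by ext; simp,
        iteratedFDeriv_add_apply (f.contDiffAt _) (g.contDiffAt _)]
      simp [mul_add])
    (fun a f => by
      ext i
      simp only [BoundedContinuousFunction.coe_ofNormedAddCommGroup,
        BoundedContinuousFunction.coe_smul, RingHom.id_apply]
      rw [show ((a • f : 𝓢(E, ℂ)) : E → ℂ) = a • ⇑f from by ext; simp,
        iteratedFDeriv_const_smul_apply (f.contDiffAt _)]
      simp [mul_left_comm])
    ⟨Finset.Iic ((K, K) : ℕ × ℕ), 1, zero_le_one, fun f => by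
      rw [one_mul]
      exact BoundedContinuousFunction.norm_ofNormedAddCommGroup_le _ (apply_nonneg _ _) _⟩

theorem jet_apply (K : ℕ) (f : 𝓢(E, ℂ)) (i : JetIndex E K) :
    jet E K f i = ((‖i.point‖ ^ i.weight : ℝ) : ℂ) * iteratedFDeriv ℝ i.order f i.point i.dir :=
  rfl

theorem norm_jet_le (K : ℕ) (f : 𝓢(E, ℂ)) : ‖jet E K f‖ ≤ supSeminorm E K f :=
  BoundedContinuousFunction.norm_ofNormedAddCommGroup_le _ (apply_nonneg _ _)
    (norm_jet_le_aux f)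

theorem supSeminorm_le_norm_jet (K : ℕ) (f : 𝓢(E, ℂ)) : supSeminorm E K f ≤ ‖jet E K f‖ := by
  refine supSeminorm_le_of (norm_nonneg _) fun k hk n hn => ?_
  refine SchwartzMap.seminorm_le_bound ℂ k n f (norm_nonneg _) fun t => ?_
  rw [← norm_norm t, ← norm_pow, ← norm_smul]
  refine ContinuousMultilinearMap.opNorm_le_bound (norm_nonneg _) fun m => ?_
  -- Normalized directions recover the operator norm by homogeneity; a zero direction stays zero.
  let i : JetIndex E K := ⟨k, hk, n, hn, t, fun j => ‖m j‖⁻¹ • m j, fun j => by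
    rw [norm_smul, norm_inv, norm_norm]
    exact inv_mul_le_one⟩
  have h := (jet E K f).norm_coe_le_norm i
  rw [jet_apply] at h
  have hm : m = fun j => ‖m j‖ • i.dir j := by
    funext j
    change m j = ‖m j‖ • ‖m j‖⁻¹ • m j
    rcases eq_or_ne (m j) 0 with h0 | h0
    · simp [h0]
    · rw [smul_inv_smul₀ (norm_ne_zero_iff.2 h0)]
  have hval : (‖t‖ ^ k • iteratedFDeriv ℝ n f t) m =
      (∏ j, ‖m j‖) • (((‖t‖ ^ k : ℝ) : ℂ) * iteratedFDeriv ℝ n f t i.dir) := by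
    conv_lhs => rw [hm, ContinuousMultilinearMap.map_smul_univ]
    simp [Complex.real_smul]
  rw [hval, norm_smul, Real.norm_of_nonneg (Finset.prod_nonneg fun _ _ => norm_nonneg _), mul_comm]
  gcongr

/-- Hahn–Banach: `u` is bounded by a single `supSeminorm`, which the norm of the jet dominates, so
`u` is a bounded functional on the range of the injective map `jet`. This transports `u` to a Banach
space, where Bochner integrals commute with functionals. -/
theorem exists_eq_comp_jet (u : 𝓢(E, ℂ) →L[ℂ] ℂ) :
    ∃ (K : ℕ) (L : StrongDual ℂ (BoundedContinuousFunction (JetIndex E K) ℂ)),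
      ∀ f, u f = L (jet E K f) := by
  obtain ⟨C, K, hC, hu⟩ := exists_norm_apply_le_supSeminorm u
  have hinj : Function.Injective (jet E K).toLinearMap := by
    rw [← LinearMap.ker_eq_bot, LinearMap.ker_eq_bot']
    intro f hf
    have h := supSeminorm_le_norm_jet K f
    have hf' : jet E K f = 0 := hf
    rw [hf', norm_zero] at h
    ext t
    have := (SchwartzMap.norm_le_seminorm ℂ f t).trans
      ((seminorm_le_supSeminorm (Nat.zero_le K) (Nat.zero_le K) f).trans h)
    simpa using this
  let e := LinearEquiv.ofInjective (jet E K).toLinearMap hinj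
  let v : StrongDual ℂ (LinearMap.range (jet E K).toLinearMap) :=
    LinearMap.mkContinuous (u.toLinearMap ∘ₗ e.symm.toLinearMap) C (fun y => by
      obtain ⟨f, rfl⟩ := e.surjective y
      simp only [LinearMap.comp_apply, LinearEquiv.coe_coe, LinearEquiv.symm_apply_apply]
      refine (hu f).trans ?_
      gcongr
      exact supSeminorm_le_norm_jet K f)
  obtain ⟨L, hL, -⟩ := exists_extension_norm_eq _ v
  refine ⟨K, L, fun f => ?_⟩
  have := hL (e f)
  have h2 : v (e f) = u f := by
    change u (e.symm (e f)) = u f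
    rw [LinearEquiv.symm_apply_apply]
  rw [h2] at this
  exact this.symm

/-! ### Integrals of families of Schwartz functions -/

section Integral

open MeasureTheory LineDeriv

theorem continuous_eval_schwartz (t : E) : Continuous fun f : 𝓢(E, ℂ) => f t :=
  (BoundedContinuousFunction.evalCLM ℂ t).continuous.comp
    (SchwartzMap.toBoundedContinuousFunctionCLM ℂ E ℂ).continuous

variable {Y : Type*} [TopologicalSpace Y] [MeasurableSpace Y] [OpensMeasurableSpace Y]
  {μ : Measure Y}

theorem lineDerivOp_apply_eq_integral {F : Y → 𝓢(E, ℂ)} (hF : Continuous F)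
    (hint : ∀ K, ∃ b : Y → ℝ, Integrable b μ ∧ ∀ y, supSeminorm E K (F y) ≤ b y)
    {f : 𝓢(E, ℂ)} (hf : ∀ t, f t = ∫ y, F y t ∂μ) (h t : E) :
    ∂_{h} f t = ∫ y, ∂_{h} (F y) t ∂μ := by
  obtain ⟨b, hb, hbF⟩ := hint 1
  have hline : ∀ (g : 𝓢(E, ℂ)) (s : ℝ),
      HasDerivAt (fun s : ℝ => g (t + s • h)) (∂_{h} g (t + s • h)) s := by
    intro g s
    have h1 : HasDerivAt (fun s : ℝ => t + s • h) h s := by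
      simpa using ((hasDerivAt_id s).smul_const h).const_add t
    exact (g.hasFDerivAt _).comp_hasDerivAt s h1
  have hcont : ∀ t, Continuous fun y => F y t := fun t => (continuous_eval_schwartz t).comp hF
  have hder := (hasDerivAt_integral_of_dominated_loc_of_deriv_le (μ := μ)
    (F := fun (s : ℝ) y => F y (t + s • h)) (F' := fun s y => ∂_{h} (F y) (t + s • h))
    (x₀ := 0) (bound := fun y => b y * ‖h‖) (s := Set.univ) Filter.univ_mem
    (Filter.Eventually.of_forall fun s => (hcont _).aestronglyMeasurable)
    (hb.mono' (hcont _).aestronglyMeasurable (Filter.Eventually.of_forall fun y =>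
      (SchwartzMap.norm_le_seminorm ℂ (F y) _).trans
        ((seminorm_le_supSeminorm zero_le_one zero_le_one _).trans (hbF y))))
    ((continuous_eval_schwartz _).comp
      ((lineDerivOpCLM ℂ 𝓢(E, ℂ) h).continuous.comp hF)).aestronglyMeasurable
    (Filter.Eventually.of_forall fun y s _ => by
      refine ((fderiv ℝ (F y) _).le_opNorm h).trans ?_
      gcongr
      rw [← norm_iteratedFDeriv_one]
      exact (SchwartzMap.norm_iteratedFDeriv_le_seminorm ℂ (F y) 1 _).trans
        ((seminorm_le_supSeminorm zero_le_one le_rfl _).trans (hbF y)))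
    (hb.mul_const _)
    (Filter.Eventually.of_forall fun y s _ => hline (F y) s)).2
  have h2 := hline f 0
  have h3 : (fun s : ℝ => f (t + s • h)) = fun s => ∫ y, F y (t + s • h) ∂μ :=
    funext fun s => hf _
  rw [h3] at h2
  simpa using h2.unique hder

/-- Induction by peeling off one direction: `∂_{h}` is continuous on the Schwartz space, so the
differentiated family again has integrable majorants for every seminorm. -/
theorem iteratedFDeriv_apply_eq_integral {F : Y → 𝓢(E, ℂ)} (hF : Continuous F)
    (hint : ∀ K, ∃ b : Y → ℝ, Integrable b μ ∧ ∀ y, supSeminorm E K (F y) ≤ b y)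
    {f : 𝓢(E, ℂ)} (hf : ∀ t, f t = ∫ y, F y t ∂μ) (n : ℕ) (m : Fin n → E) (t : E) :
    iteratedFDeriv ℝ n f t m = ∫ y, iteratedFDeriv ℝ n (F y) t m ∂μ := by
  simp only [← SchwartzMap.iteratedLineDerivOp_eq_iteratedFDeriv]
  induction n generalizing F f with
  | zero => simpa using hf t
  | succ n ih =>
    simp only [iteratedLineDerivOp_succ_right]
    refine ih ((lineDerivOpCLM ℂ 𝓢(E, ℂ) (m (Fin.last n))).continuous.comp hF) (fun K => ?_)
      (fun t => lineDerivOp_apply_eq_integral hF hint hf _ t) _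
    obtain ⟨C, L, hC, hCL⟩ := exists_supSeminorm_apply_le
      (lineDerivOpCLM ℂ 𝓢(E, ℂ) (m (Fin.last n))) K
    obtain ⟨b, hb, hbF⟩ := hint L
    refine ⟨fun y => C * b y, hb.const_mul C, fun y => (hCL (F y)).trans ?_⟩
    exact mul_le_mul_of_nonneg_left (hbF y) hC

/-- A continuous functional on the Schwartz space commutes with absolutely convergent
integrals. -/
theorem apply_eq_integral [SecondCountableTopology Y] (u : 𝓢(E, ℂ) →L[ℂ] ℂ) {F : Y → 𝓢(E, ℂ)}
    (hF : Continuous F)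
    (hint : ∀ K, ∃ b : Y → ℝ, Integrable b μ ∧ ∀ y, supSeminorm E K (F y) ≤ b y)
    {f : 𝓢(E, ℂ)} (hf : ∀ t, f t = ∫ y, F y t ∂μ) : u f = ∫ y, u (F y) ∂μ := by
  obtain ⟨K, L, hL⟩ := exists_eq_comp_jet u
  obtain ⟨b, hb, hbF⟩ := hint K
  have hI : Integrable (fun y => jet E K (F y)) μ :=
    hb.mono' ((jet E K).continuous.comp hF).aestronglyMeasurable
      (Filter.Eventually.of_forall fun y => (norm_jet_le K _).trans (hbF y))
  simp only [hL]
  rw [L.integral_comp_comm hI]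
  congr 1
  ext i
  -- The two jets are compared one coordinate at a time; each coordinate is a weighted derivative,
  -- which may be taken under the integral.
  have h1 := (BoundedContinuousFunction.evalCLM ℂ i).integral_comp_comm hI
  refine Eq.trans ?_ h1
  change ((‖i.point‖ ^ i.weight : ℝ) : ℂ) * iteratedFDeriv ℝ i.order f i.point i.dir =
    ∫ y, ((‖i.point‖ ^ i.weight : ℝ) : ℂ) * iteratedFDeriv ℝ i.order (F y) i.point i.dir ∂μ
  rw [integral_const_mul, iteratedFDeriv_apply_eq_integral hF hint hf]

end Integral

/-! ### The Fourier transform of a localized distribution -/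

/-- The Fourier transform `η ↦ u(e^{-i⟨·, η⟩} Θ)` of the localized distribution `Θ u`. -/
def freq (u : 𝓢(Space d, ℂ) →L[ℂ] ℂ) (Θ : 𝓢(Space d, ℂ)) (η : Space d) : ℂ :=
  u (SchwartzMap.smulLeftCLM ℂ (osc η) Θ)

theorem supSeminorm_oscRemainder_le (K M : ℕ) (y : Space d) (f : 𝓢(Space d, ℂ)) :
    supSeminorm (Space d) K (SchwartzMap.smulLeftCLM ℂ (oscRemainder M y) f) ≤
      (‖y‖ ^ M * (1 + ‖y‖) ^ K) * (2 ^ K * 2 ^ (K + M) * supSeminorm (Space d) (K + M) f) :=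
  supSeminorm_smulLeftCLM_le (hasTemperateGrowth_oscRemainder M y)
    (fun _ hj t => norm_iteratedFDeriv_oscRemainder_le' hj M y t) f

theorem supSeminorm_osc_le (K : ℕ) (η : Space d) (f : 𝓢(Space d, ℂ)) :
    supSeminorm (Space d) K (SchwartzMap.smulLeftCLM ℂ (osc η) f) ≤
      (1 + ‖η‖) ^ K * (2 ^ K * 2 ^ K * supSeminorm (Space d) K f) := by
  have := supSeminorm_oscRemainder_le K 0 η f
  rwa [oscRemainder_zero, pow_zero, one_mul, add_zero] at this

/-- Multiplication by `t ↦ -i⟨t, y⟩`. -/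
def mulInner (y : Space d) : 𝓢(Space d, ℂ) →L[ℂ] 𝓢(Space d, ℂ) :=
  SchwartzMap.smulLeftCLM ℂ (fun t : Space d => -(Complex.I * (inner ℝ t y : ℝ)))

theorem mulInner_apply (y : Space d) (f : 𝓢(Space d, ℂ)) (t : Space d) :
    mulInner y f t = -(Complex.I * (inner ℝ t y : ℝ)) * f t := by
  unfold mulInner
  rw [SchwartzMap.smulLeftCLM_apply_apply, smul_eq_mul]
  have h1 : Function.HasTemperateGrowth (fun t : Space d => (inner ℝ t y : ℝ)) :=
    Function.hasTemperateGrowth_inner_left y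
  have h2 : Function.HasTemperateGrowth (fun t : Space d => ((inner ℝ t y : ℝ) : ℂ)) :=
    Function.HasTemperateGrowth.comp
      Function.Complex.hasTemperateGrowth_ofReal h1
  exact ((Function.HasTemperateGrowth.const Complex.I).mul h2).neg

theorem mulInner_iterate_apply (y : Space d) (k : ℕ) (f : 𝓢(Space d, ℂ)) (t : Space d) :
    ((mulInner y)^[k] f) t = (-(Complex.I * (inner ℝ t y : ℝ))) ^ k * f t := by
  induction k generalizing f with
  | zero => simp
  | succ k ih =>
    rw [Function.iterate_succ_apply, ih, mulInner_apply]
    ring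

theorem smulLeftCLM_osc_oscRemainder (ξ y : Space d) (M : ℕ) (f : 𝓢(Space d, ℂ)) :
    SchwartzMap.smulLeftCLM ℂ (osc ξ) (SchwartzMap.smulLeftCLM ℂ (oscRemainder M y) f) =
      SchwartzMap.smulLeftCLM ℂ (osc (ξ + y)) f -
        ∑ k ∈ Finset.range M, ((k.factorial : ℂ)⁻¹) •
          SchwartzMap.smulLeftCLM ℂ (osc ξ) ((mulInner y)^[k] f) := by
  ext t
  rw [SchwartzMap.smulLeftCLM_apply_apply (hasTemperateGrowth_osc ξ),
    SchwartzMap.smulLeftCLM_apply_apply (hasTemperateGrowth_oscRemainder M y)]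
  simp only [sub_apply, sum_apply, smul_apply, smul_eq_mul,
    SchwartzMap.smulLeftCLM_apply_apply (hasTemperateGrowth_osc _), mulInner_iterate_apply,
    osc_add, oscRemainder, expRemainder]
  rw [sub_mul, mul_sub, Finset.sum_mul, Finset.mul_sum]
  congr 1
  · simp only [osc]
    ring
  · refine Finset.sum_congr rfl fun k _ => ?_
    field_simp

/-- The error is `u` applied to `Θ` times an oscillation and an oscillatory remainder. The exponent
`K` is the order of `u` and is fixed before `M`, which later allows `M` to be chosen in terms of
`K`. -/
theorem exists_freq_taylor_bound (u : 𝓢(Space d, ℂ) →L[ℂ] ℂ) :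
    ∃ K : ℕ, ∀ (Θ : 𝓢(Space d, ℂ)) (M : ℕ), ∃ C : ℝ, 0 ≤ C ∧ ∀ ξ y : Space d,
      ‖freq u Θ (ξ + y) - ∑ k ∈ Finset.range M,
        ((k.factorial : ℂ)⁻¹) * freq u ((mulInner y)^[k] Θ) ξ‖ ≤
      C * (1 + ‖ξ‖) ^ K * (‖y‖ ^ M * (1 + ‖y‖) ^ K) := by
  obtain ⟨C, K, hC, hu⟩ := exists_norm_apply_le_supSeminorm u
  refine ⟨K, fun Θ M => ⟨C * (2 ^ K * 2 ^ K) *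
    (2 ^ K * 2 ^ (K + M) * supSeminorm (Space d) (K + M) Θ), by positivity, fun ξ y => ?_⟩⟩
  have heq : freq u Θ (ξ + y) - ∑ k ∈ Finset.range M,
      ((k.factorial : ℂ)⁻¹) * freq u ((mulInner y)^[k] Θ) ξ =
      u (SchwartzMap.smulLeftCLM ℂ (osc ξ)
        (SchwartzMap.smulLeftCLM ℂ (oscRemainder M y) Θ)) := by
    rw [smulLeftCLM_osc_oscRemainder, map_sub, map_sum]
    simp [freq]
  rw [heq]
  calc _ ≤ C * _ := hu _
    _ ≤ C * ((1 + ‖ξ‖) ^ K * (2 ^ K * 2 ^ K * ((‖y‖ ^ M * (1 + ‖y‖) ^ K) *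
          (2 ^ K * 2 ^ (K + M) * supSeminorm (Space d) (K + M) Θ)))) := by
        gcongr
        refine (supSeminorm_osc_le K ξ _).trans ?_
        gcongr
        exact supSeminorm_oscRemainder_le K M y Θ
    _ = _ := by ring

theorem exists_freq_bound (u : 𝓢(Space d, ℂ) →L[ℂ] ℂ) (Θ : 𝓢(Space d, ℂ)) :
    ∃ (C : ℝ) (K : ℕ), 0 ≤ C ∧ ∀ η : Space d, ‖freq u Θ η‖ ≤ C * (1 + ‖η‖) ^ K := by
  obtain ⟨K, hK⟩ := exists_freq_taylor_bound u
  obtain ⟨C, hC, h⟩ := hK Θ 0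
  refine ⟨C, K, hC, fun η => ?_⟩
  simpa using h 0 η

/-- The difference of two oscillations is an oscillation times a remainder of order one, whose
seminorm bound tends to zero with `x - η`. -/
theorem continuous_smulLeftCLM_osc (f : 𝓢(Space d, ℂ)) :
    Continuous fun η : Space d => SchwartzMap.smulLeftCLM ℂ (osc η) f := by
  refine continuous_iff_continuousAt.2 fun η => ?_
  refine ((schwartz_withSeminorms ℂ (Space d) ℂ).tendsto_nhds _ _).2 ?_
  intro i ε hε
  set K := i.1 + i.2
  set D : ℝ := 2 ^ K * 2 ^ (K + 1) * supSeminorm (Space d) (K + 1) f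
  have hlim : Filter.Tendsto (fun x : Space d => (1 + ‖η‖) ^ K * (2 ^ K * 2 ^ K *
      ((‖x - η‖ ^ 1 * (1 + ‖x - η‖) ^ K) * D))) (nhds η) (nhds 0) := by
    have hc : Continuous (fun x : Space d => (1 + ‖η‖) ^ K * (2 ^ K * 2 ^ K *
      ((‖x - η‖ ^ 1 * (1 + ‖x - η‖) ^ K) * D))) := by fun_prop
    simpa using hc.tendsto η
  filter_upwards [hlim.eventually_lt_const hε] with x hx
  refine lt_of_le_of_lt ?_ hx
  have heq : SchwartzMap.smulLeftCLM ℂ (osc x) f - SchwartzMap.smulLeftCLM ℂ (osc η) f =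
      SchwartzMap.smulLeftCLM ℂ (osc η)
        (SchwartzMap.smulLeftCLM ℂ (oscRemainder 1 (x - η)) f) := by
    rw [smulLeftCLM_osc_oscRemainder]
    simp
  rw [heq]
  calc SchwartzMap.seminorm ℂ i.1 i.2 _ ≤ supSeminorm (Space d) K _ :=
        seminorm_le_supSeminorm (Nat.le_add_right _ _) (Nat.le_add_left _ _) _
    _ ≤ _ := supSeminorm_osc_le K η _
    _ ≤ _ := by
        gcongr
        exact supSeminorm_oscRemainder_le K 1 _ f

theorem continuous_freq (u : 𝓢(Space d, ℂ) →L[ℂ] ℂ) (Θ : 𝓢(Space d, ℂ)) :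
    Continuous (freq u Θ) :=
  u.continuous.comp (continuous_smulLeftCLM_osc Θ)

theorem one_add_norm_add_le (x y : Space d) : 1 + ‖x + y‖ ≤ (1 + ‖x‖) * (1 + ‖y‖) := by
  nlinarith [norm_add_le x y, norm_nonneg x, norm_nonneg y,
    mul_nonneg (norm_nonneg x) (norm_nonneg y)]

theorem one_add_norm_smul_le (c : ℝ) (x : Space d) :
    1 + ‖c • x‖ ≤ (1 + |c|) * (1 + ‖x‖) := by
  rw [norm_smul, Real.norm_eq_abs]
  nlinarith [norm_nonneg x, abs_nonneg c, mul_nonneg (abs_nonneg c) (norm_nonneg x)]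

open MeasureTheory

theorem integrable_one_add_norm_pow_mul (κ : 𝓢(Space d, ℂ)) (k : ℕ) :
    Integrable fun s : Space d => (1 + ‖s‖) ^ k * ‖κ s‖ := by
  have h : ∀ s : Space d, (1 + ‖s‖) ^ k * ‖κ s‖ =
      ∑ i ∈ Finset.range (k + 1), (k.choose i : ℝ) * (‖s‖ ^ i * ‖κ s‖) := fun s => by
    rw [add_comm, add_pow, Finset.sum_mul]
    refine Finset.sum_congr rfl fun i _ => ?_
    ring
  simp_rw [h]
  exact integrable_finsetSum _ fun i _ => (κ.integrable_pow_mul volume i).const_mul _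

theorem continuous_osc_left (t : Space d) : Continuous fun η : Space d => osc η t := by
  unfold osc
  fun_prop

/-- Multiplying a localized distribution by a superposition of oscillations averages its Fourier
transform. -/
theorem freq_eq_integral (u : 𝓢(Space d, ℂ) →L[ℂ] ℂ) (Θ κ f : 𝓢(Space d, ℂ)) (μ : ℝ)
    (x ξ : Space d) (hf : ∀ t, f t = (∫ s, κ s * osc (μ • s) (t - x)) * Θ t) :
    freq u f ξ = ∫ s, κ s * osc (μ • s) (-x) * freq u Θ (ξ + μ • s) := by
  have hc : Continuous fun s : Space d => κ s * osc (μ • s) (-x) :=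
    κ.continuous.mul ((continuous_osc_left (-x)).comp (continuous_const_smul μ))
  have := apply_eq_integral (μ := volume) u
    (F := fun s : Space d => (κ s * osc (μ • s) (-x)) •
      SchwartzMap.smulLeftCLM ℂ (osc (ξ + μ • s)) Θ)
    (f := SchwartzMap.smulLeftCLM ℂ (osc ξ) f)
    (hc.smul ((continuous_smulLeftCLM_osc Θ).comp (by fun_prop)))
    (fun K => ?_) (fun t => ?_)
  · refine this.trans (integral_congr_ae (Filter.Eventually.of_forall fun s => ?_))
    simp [freq]
  · set D := 2 ^ K * 2 ^ K * supSeminorm (Space d) K Θ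
    have hD : 0 ≤ D := by positivity
    refine ⟨fun s => ((1 + ‖ξ‖) * (1 + |μ|)) ^ K * D * ((1 + ‖s‖) ^ K * ‖κ s‖),
      (integrable_one_add_norm_pow_mul κ K).const_mul _, fun s => ?_⟩
    rw [map_smul_eq_mul, norm_mul, norm_osc, mul_one]
    calc _ ≤ ‖κ s‖ * ((1 + ‖ξ + μ • s‖) ^ K * D) := by
          gcongr
          exact supSeminorm_osc_le K _ Θ
      _ ≤ ‖κ s‖ * (((1 + ‖ξ‖) * ((1 + |μ|) * (1 + ‖s‖))) ^ K * D) := by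
          gcongr
          exact (one_add_norm_add_le _ _).trans (by gcongr; exact one_add_norm_smul_le _ _)
      _ = _ := by rw [← mul_assoc (1 + ‖ξ‖), mul_pow _ (1 + ‖s‖)]; ring
  · rw [SchwartzMap.smulLeftCLM_apply_apply (hasTemperateGrowth_osc ξ), hf t, smul_eq_mul,
      ← mul_assoc, mul_comm (osc ξ t), mul_assoc, ← integral_mul_const]
    refine integral_congr_ae (Filter.Eventually.of_forall fun s => ?_)
    simp only [smul_apply, smul_eq_mul,
      SchwartzMap.smulLeftCLM_apply_apply (hasTemperateGrowth_osc _), osc_add]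
    have h1 : osc (μ • s) (t - x) = osc (μ • s) (-x) * osc (μ • s) t := by
      simp only [osc, ← Complex.exp_add, inner_sub_left, inner_neg_left]
      congr 1
      push_cast
      ring
    rw [h1]
    ring

theorem fourier_smul_eq_integral (κ : 𝓢(Space d, ℂ)) (c : ℝ) (w : Space d) :
    (𝓕 κ) (c • w) = ∫ s, κ s * osc ((2 * Real.pi * c) • s) w := by
  rw [SchwartzMap.fourier_coe, Real.fourier_eq']
  refine integral_congr_ae (Filter.Eventually.of_forall fun s => ?_)
  simp only [osc, smul_eq_mul, inner_smul_right, real_inner_comm w s]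
  rw [mul_comm]
  congr 2
  push_cast
  ring

/-! ### The short-time Fourier transform in terms of the Fourier transform -/

/-- The complex conjugate of the Fourier transform of the window. -/
def dualWindow (φ : 𝓢(Space d, ℂ)) : 𝓢(Space d, ℂ) := 𝓕⁻ (conjSchwartz φ)

theorem fourier_dualWindow (φ : 𝓢(Space d, ℂ)) : 𝓕 (dualWindow φ) = conjSchwartz φ := by
  simp [dualWindow]

theorem dualWindow_apply (φ : 𝓢(Space d, ℂ)) (s : Space d) :
    dualWindow φ s = (starRingEnd ℂ) (𝓕 (φ : Space d → ℂ) s) := by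
  unfold dualWindow
  rw [SchwartzMap.fourierInv_coe, Real.fourierInv_eq', Real.fourier_eq', ← integral_conj]
  refine integral_congr_ae (Filter.Eventually.of_forall fun t => ?_)
  simp only [smul_eq_mul, map_mul, conjSchwartz_apply, ← Complex.exp_conj]
  congr 2
  simp [Complex.conj_ofNat]

theorem dualWindow_eq_zero_iff {φ : 𝓢(Space d, ℂ)} : dualWindow φ = 0 ↔ φ = 0 := by
  constructor
  · intro h
    have h1 := fourier_dualWindow φ
    rw [h] at h1
    ext t
    have h2 : conjSchwartz φ t = 0 := by
      rw [← h1]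
      simp
    simpa using h2
  · rintro rfl
    ext s
    rw [dualWindow_apply]
    simp [Real.fourier_eq']

theorem IsAdmissibleWindow.exists_dualWindow_support {α : ℝ} {φ : 𝓢(Space d, ℂ)}
    (h : IsAdmissibleWindow α φ) :
    ∃ r : ℝ, 0 < r ∧ ∀ s, dualWindow φ s ≠ 0 → ‖s‖ ≤ r := by
  obtain ⟨c₁, c₂, h1, h2, h3⟩ := h.fourier_support
  refine ⟨c₂, h1.trans h2, fun s hs => ?_⟩
  have hpi : 0 < 2 * Real.pi := by positivity
  have := (h3 ((2 * Real.pi) • s) (by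
    intro h0
    apply hs
    rw [dualWindow_apply]
    unfold fourierHat at h0
    rw [inv_smul_smul₀ hpi.ne'] at h0
    rw [h0, map_zero])).2
  rw [norm_smul, Real.norm_of_nonneg hpi.le] at this
  -- The normalization turns the radius `c₂` into `c₂ / (2π)`; the larger radius `c₂` is kept.
  have h4 : 1 ≤ 2 * Real.pi := by linarith [Real.pi_gt_three]
  nlinarith [norm_nonneg s]

/-- The short-time Fourier transform of a localized distribution in terms of its Fourier
transform, without the normalizing factor. -/
def averagedFreq (u : 𝓢(Space d, ℂ) →L[ℂ] ℂ) (Θ ψ : 𝓢(Space d, ℂ)) (μ : ℝ) (x ξ : Space d) : ℂ :=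
  ∫ s, ψ s * osc (μ • s) (-x) * freq u Θ (ξ + μ • s)

/-- The product of the cut-off with the conjugate of the rescaled window. -/
def localizedWindow (φ Θ : 𝓢(Space d, ℂ)) (hΘ : HasCompactSupport Θ) (c : ℝ) (x : Space d) :
    𝓢(Space d, ℂ) :=
  HasCompactSupport.toSchwartzMap (f := fun t => (conjSchwartz φ) (c • (t - x)) * Θ t)
    hΘ.mul_left
    ((((conjSchwartz φ).smooth ⊤).comp
      ((contDiff_id.sub contDiff_const).const_smul c)).mul (Θ.smooth ⊤))

theorem localizedWindow_apply (φ Θ : 𝓢(Space d, ℂ)) (hΘ : HasCompactSupport Θ) (c : ℝ)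
    (x t : Space d) :
    localizedWindow φ Θ hΘ c x t = (starRingEnd ℂ) (φ (c • (t - x))) * Θ t := rfl

/-- A tempered distribution as a continuous functional. -/
def distribCLM (u : 𝓢'(Space d, ℂ)) : 𝓢(Space d, ℂ) →L[ℂ] ℂ := u

theorem distribCLM_apply (u : 𝓢'(Space d, ℂ)) (f : 𝓢(Space d, ℂ)) : distribCLM u f = u f := rfl

theorem dispersiveSTFT_eq_freq (α : ℝ) (φ Θ : 𝓢(Space d, ℂ)) (hΘ : HasCompactSupport Θ)
    (u : 𝓢'(Space d, ℂ)) (x : Space d) {ξ : Space d} (hξ : ξ ≠ 0) :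
    dispersiveSTFT α φ (TemperedDistribution.smulLeftCLM ℂ Θ u) x ξ =
      ((‖ξ‖ ^ ((d : ℝ) / 2 * (1 - α)) : ℝ) : ℂ) *
        freq (distribCLM u) (localizedWindow φ Θ hΘ (‖ξ‖ ^ (1 - α)) x) ξ := by
  unfold dispersiveSTFT freq
  rw [TemperedDistribution.smulLeftCLM_apply_apply, ← distribCLM_apply, ← smul_eq_mul, ← map_smul]
  congr 1
  ext t
  rw [SchwartzMap.smulLeftCLM_apply_apply Θ.hasTemperateGrowth, conjSchwartz_apply,
    packet_apply α φ x hξ, smul_apply,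
    SchwartzMap.smulLeftCLM_apply_apply (hasTemperateGrowth_osc ξ), localizedWindow_apply]
  simp only [map_mul, Complex.conj_ofReal, smul_eq_mul, ← Complex.exp_conj, Complex.conj_I, osc]
  rw [neg_mul]
  ring

/-- The conjugated window is the Fourier transform of `dualWindow φ`, hence a superposition of
oscillations, each of which shifts the frequency of the localized distribution. -/
theorem freq_localizedWindow (φ Θ : 𝓢(Space d, ℂ)) (hΘ : HasCompactSupport Θ) (c : ℝ)
    (u : 𝓢(Space d, ℂ) →L[ℂ] ℂ) (x ξ : Space d) :
    freq u (localizedWindow φ Θ hΘ c x) ξ =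
      averagedFreq u Θ (dualWindow φ) (2 * Real.pi * c) x ξ := by
  refine freq_eq_integral u Θ (dualWindow φ) _ _ x ξ fun t => ?_
  rw [localizedWindow_apply, ← fourier_smul_eq_integral, fourier_dualWindow, conjSchwartz_apply]

/-! ### Cones and elementary estimates -/

theorem IsOpenCone.exists_smaller {Γ : Set (Space d)} (hΓ : IsOpenCone Γ) {ξ₀ : Space d}
    (h₀ : ξ₀ ∈ Γ) :
    ∃ (Γ' : Set (Space d)) (ε : ℝ), IsOpenCone Γ' ∧ ξ₀ ∈ Γ' ∧ 0 < ε ∧ ε ≤ 1 / 2 ∧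
      ∀ ξ ∈ Γ', ∀ η, ‖η - ξ‖ ≤ ε * ‖ξ‖ → η ∈ Γ := by
  have hpos : 0 < ‖ξ₀‖ := norm_pos_iff.2 (hΓ.ne_zero _ h₀)
  set θ := ‖ξ₀‖⁻¹ • ξ₀ with hθ
  have hθΓ : θ ∈ Γ := hΓ.smul_mem _ h₀ _ (inv_pos.2 hpos)
  obtain ⟨δ, hδ, hball⟩ := Metric.isOpen_iff.1 hΓ.isOpen θ hθΓ
  -- Half of the aperture `δ` goes to the smaller cone and half to the displacement. The bound `1 /
  -- 2` ensures that displaced frequencies keep at least half their size.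
  set ε := min (δ / 2) (1 / 2) with hε
  have hε0 : 0 < ε := lt_min (by linarith) (by norm_num)
  have hθξ : ‖ξ₀‖ • θ = ξ₀ := by rw [hθ, smul_inv_smul₀ hpos.ne']
  refine ⟨{ξ | ‖ξ - ‖ξ‖ • θ‖ < ε * ‖ξ‖}, ε, ⟨?_, ?_, ?_⟩, ?_, hε0, min_le_right _ _, ?_⟩
  · exact isOpen_lt (by fun_prop) (by fun_prop)
  · rintro ξ hξ rfl
    simp at hξ
  · intro ξ hξ s hs
    simp only [Set.mem_ofPred_eq] at hξ ⊢
    rw [norm_smul, Real.norm_of_nonneg hs.le, mul_smul, ← smul_sub, norm_smul,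
      Real.norm_of_nonneg hs.le, mul_left_comm]
    gcongr
  · simp only [Set.mem_ofPred_eq]
    rw [hθξ, sub_self, norm_zero]
    positivity
  · intro ξ hξ η hη
    simp only [Set.mem_ofPred_eq] at hξ
    have hξ0 : 0 < ‖ξ‖ := by
      rcases (norm_nonneg ξ).eq_or_lt with h | h
      · rw [← h, mul_zero] at hξ
        exact absurd hξ (not_lt.2 (norm_nonneg _))
      · exact h
    have hmem : ‖ξ‖⁻¹ • η ∈ Γ := by
      refine hball ?_
      rw [Metric.mem_ball, dist_eq_norm]
      have h1 : ‖ξ‖⁻¹ • η - θ = ‖ξ‖⁻¹ • ((η - ξ) + (ξ - ‖ξ‖ • θ)) := by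
        rw [sub_add_sub_cancel, smul_sub, inv_smul_smul₀ hξ0.ne']
      rw [h1, norm_smul, norm_inv, norm_norm, inv_mul_lt_iff₀ hξ0]
      calc _ ≤ ‖η - ξ‖ + ‖ξ - ‖ξ‖ • θ‖ := norm_add_le _ _
        _ < ε * ‖ξ‖ + ε * ‖ξ‖ := by linarith
        _ ≤ ‖ξ‖ * δ := by
          have : ε ≤ δ / 2 := min_le_left _ _
          nlinarith
    have := hΓ.smul_mem _ hmem ‖ξ‖ hξ0
    rwa [smul_inv_smul₀ hξ0.ne'] at this

theorem exists_mul_rpow_le {α : ℝ} (hα : 0 < α) (c : ℝ) {ε : ℝ} (hε : 0 < ε) :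
    ∃ R : ℝ, 1 ≤ R ∧ ∀ r, R ≤ r → c * r ^ (1 - α) ≤ ε * r := by
  have h := (tendsto_rpow_neg_atTop hα).const_mul c
  rw [mul_zero] at h
  obtain ⟨R, hR⟩ := Filter.eventually_atTop.1 (h.eventually_le_const hε)
  refine ⟨max R 1, le_max_right _ _, fun r hr => ?_⟩
  have hr0 : 0 < r := lt_of_lt_of_le one_pos ((le_max_right _ _).trans hr)
  have h1 := hR r ((le_max_left _ _).trans hr)
  rw [sub_eq_add_neg, Real.rpow_add hr0, Real.rpow_one]
  nlinarith

/-- Staying away from the origin also handles negative exponents, so normalizing factors can be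
moved across rapid-decay estimates. -/
theorem exists_rpow_le_one_add_pow {R : ℝ} (hR : 0 < R) (p : ℝ) :
    ∃ (C : ℝ) (K : ℕ), 0 < C ∧ ∀ r, R ≤ r → r ^ p ≤ C * (1 + r) ^ K := by
  refine ⟨1 + R ^ p, ⌈p⌉₊, by positivity, fun r hr => ?_⟩
  have hr0 : 0 < r := hR.trans_le hr
  have hp : 0 < R ^ p := by positivity
  rcases le_total 0 p with h | h
  · have h1 : r ^ p ≤ (1 + r) ^ (⌈p⌉₊) := by
      rw [← Real.rpow_natCast]
      exact (Real.rpow_le_rpow hr0.le (by linarith) h).trans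
        (Real.rpow_le_rpow_of_exponent_le (by linarith) (Nat.le_ceil p))
    nlinarith [pow_pos (show 0 < 1 + r by linarith) ⌈p⌉₊]
  · have h1 : r ^ p ≤ R ^ p := Real.rpow_le_rpow_of_nonpos hR hr h
    have h2 : 1 ≤ (1 + r) ^ ⌈p⌉₊ := one_le_pow₀ (by linarith)
    nlinarith

theorem mul_norm_integral_le {X : Type*} [MeasurableSpace X] {μ : Measure X} {f : X → ℂ}
    {g : X → ℝ} {c : ℝ} (hc : 0 ≤ c) (hg : Integrable g μ) (h : ∀ s, c * ‖f s‖ ≤ g s) :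
    c * ‖∫ s, f s ∂μ‖ ≤ ∫ s, g s ∂μ := by
  have h1 : c * ‖∫ s, f s ∂μ‖ = ‖∫ s, (c : ℂ) * f s ∂μ‖ := by
    rw [integral_const_mul, norm_mul, Complex.norm_real, Real.norm_of_nonneg hc]
  rw [h1]
  refine norm_integral_le_of_norm_le hg (Filter.Eventually.of_forall fun s => ?_)
  rw [norm_mul, Complex.norm_real, Real.norm_of_nonneg hc]
  exact h s

/-! ### Microlocal regularity -/

/-- Microlocal regularity in the classical sense of Hörmander: a cut-off of `u` has a Fourier
transform that decays rapidly in a cone. -/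
def IsMicrolocallyRegularAt (u : 𝓢(Space d, ℂ) →L[ℂ] ℂ) (x₀ ξ₀ : Space d) : Prop :=
  ∃ (Θ : 𝓢(Space d, ℂ)) (Γ : Set (Space d)) (R : ℝ), HasCompactSupport Θ ∧ Θ x₀ ≠ 0 ∧
    IsOpenCone Γ ∧ ξ₀ ∈ Γ ∧
    ∀ N : ℕ, ∃ C : ℝ, 0 ≤ C ∧ ∀ ξ ∈ Γ, R ≤ ‖ξ‖ → (1 + ‖ξ‖) ^ N * ‖freq u Θ ξ‖ ≤ C

/-- Rapid decay of the averages `averagedFreq` over `U × Γ`. -/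
def AveragesDecay (α : ℝ) (ψ : 𝓢(Space d, ℂ)) (u : 𝓢(Space d, ℂ) →L[ℂ] ℂ) (Θ : 𝓢(Space d, ℂ))
    (U Γ : Set (Space d)) (R : ℝ) : Prop :=
  ∀ N : ℕ, ∃ C : ℝ, 0 ≤ C ∧ ∀ x ∈ U, ∀ ξ ∈ Γ, R ≤ ‖ξ‖ →
    (1 + ‖ξ‖) ^ N * ‖averagedFreq u Θ ψ (2 * Real.pi * ‖ξ‖ ^ (1 - α)) x ξ‖ ≤ C

theorem AveragesDecay.mono {α : ℝ} {ψ : 𝓢(Space d, ℂ)} {u : 𝓢(Space d, ℂ) →L[ℂ] ℂ}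
    {Θ : 𝓢(Space d, ℂ)} {U Γ : Set (Space d)} {R R' : ℝ} (h : AveragesDecay α ψ u Θ U Γ R)
    (hR : R ≤ R') : AveragesDecay α ψ u Θ U Γ R' := fun N => by
  obtain ⟨C, hC, hb⟩ := h N
  exact ⟨C, hC, fun x hx ξ hξ hle => hb x hx ξ hξ (hR.trans hle)⟩

theorem norm_stft_mul_rpow {α : ℝ} {φ : 𝓢(Space d, ℂ)} {u : 𝓢'(Space d, ℂ)}
    (Θ : 𝓢(Space d, ℂ)) (hΘ : HasCompactSupport Θ) (x : Space d) {ξ : Space d} (hξ : ξ ≠ 0) :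
    ‖dispersiveSTFT α φ (TemperedDistribution.smulLeftCLM ℂ Θ u) x ξ‖ =
      ‖ξ‖ ^ ((d : ℝ) / 2 * (1 - α)) *
        ‖averagedFreq (distribCLM u) Θ (dualWindow φ) (2 * Real.pi * ‖ξ‖ ^ (1 - α)) x ξ‖ := by
  rw [dispersiveSTFT_eq_freq α φ Θ hΘ u x hξ, freq_localizedWindow, norm_mul, Complex.norm_real,
    Real.norm_of_nonneg (by positivity)]

theorem isGaborRegularAt_iff {α : ℝ} (hα : 0 < α) {φ : 𝓢(Space d, ℂ)} {u : 𝓢'(Space d, ℂ)}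
    {x₀ ξ₀ : Space d} :
    IsGaborRegularAt α φ u x₀ ξ₀ ↔
      ∃ (Θ : 𝓢(Space d, ℂ)) (U Γ : Set (Space d)) (R : ℝ), HasCompactSupport Θ ∧ Θ x₀ ≠ 0 ∧
        IsOpen U ∧ x₀ ∈ U ∧ IsOpenCone Γ ∧ ξ₀ ∈ Γ ∧ 0 < R ∧
        AveragesDecay α (dualWindow φ) (distribCLM u) Θ U Γ R := by
  constructor
  · rintro ⟨χ, U, Γ, R, h1, h2, h3, h4, h5, h6, h7, -, h8, h9⟩
    refine ⟨h2.toSchwartzMap h1, U, Γ, R, h2, h3, h4, h5, h6, h7, h8, fun N => ?_⟩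
    obtain ⟨C', K, hC', hK⟩ := exists_rpow_le_one_add_pow h8 (-((d : ℝ) / 2 * (1 - α)))
    obtain ⟨C, hC⟩ := h9 (N + K)
    refine ⟨C' * max C 0, by positivity, fun x hx ξ hξ hR => ?_⟩
    have hξ0 : 0 < ‖ξ‖ := h8.trans_le hR
    have hV := hC x hx ξ hξ hR
    have heq := norm_stft_mul_rpow (α := α) (φ := φ) (u := u) (h2.toSchwartzMap h1) h2 x
      (norm_pos_iff.1 hξ0)
    change ‖dispersiveSTFT α φ (TemperedDistribution.smulLeftCLM ℂ χ u) x ξ‖ = _ at heq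
    rw [heq] at hV
    set B := ‖averagedFreq (distribCLM u) (h2.toSchwartzMap h1) (dualWindow φ)
      (2 * Real.pi * ‖ξ‖ ^ (1 - α)) x ξ‖
    have hB : B = ‖ξ‖ ^ (-((d : ℝ) / 2 * (1 - α))) * (‖ξ‖ ^ ((d : ℝ) / 2 * (1 - α)) * B) := by
      rw [← mul_assoc, ← Real.rpow_add hξ0, neg_add_cancel, Real.rpow_zero, one_mul]
    have hpos : 0 < 1 + ‖ξ‖ := by positivity
    calc (1 + ‖ξ‖) ^ N * B
        = (1 + ‖ξ‖) ^ N * (‖ξ‖ ^ (-((d : ℝ) / 2 * (1 - α))) *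
            (‖ξ‖ ^ ((d : ℝ) / 2 * (1 - α)) * B)) := by rw [← hB]
      _ ≤ (1 + ‖ξ‖) ^ N * ((C' * (1 + ‖ξ‖) ^ K) * (max C 0 * ((1 + ‖ξ‖) ^ (N + K))⁻¹)) := by
          refine mul_le_mul_of_nonneg_left (mul_le_mul (hK _ hR) (hV.trans ?_) (by positivity)
            (by positivity)) (by positivity)
          exact mul_le_mul_of_nonneg_right (le_max_left _ _) (by positivity)
      _ = C' * max C 0 := by
          rw [pow_add]
          field_simp
  · rintro ⟨Θ, U, Γ, R, h2, h3, h4, h5, h6, h7, h8, h9⟩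
    refine ⟨Θ, U, Γ, R, Θ.smooth ⊤, h2, h3, h4, h5, h6, h7,
      -- For `α > 0` the condition `1 ≤ ‖ξ‖ ^ α` holds as soon as `‖ξ‖ ≥ 1`.
      ⟨1, fun ξ _ h => Real.one_le_rpow h hα.le⟩, h8, fun N => ?_⟩
    obtain ⟨C', K, hC', hK⟩ := exists_rpow_le_one_add_pow h8 ((d : ℝ) / 2 * (1 - α))
    obtain ⟨C, hC, hB⟩ := h9 (N + K)
    refine ⟨C' * C, fun x hx ξ hξ hR => ?_⟩
    have hξ0 : 0 < ‖ξ‖ := h8.trans_le hR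
    have hpos : 0 < 1 + ‖ξ‖ := by positivity
    rw [norm_stft_mul_rpow Θ h2 x (norm_pos_iff.1 hξ0), ← div_eq_mul_inv, le_div_iff₀ (by positivity)]
    set B := ‖averagedFreq (distribCLM u) Θ (dualWindow φ) (2 * Real.pi * ‖ξ‖ ^ (1 - α)) x ξ‖
    calc ‖ξ‖ ^ ((d : ℝ) / 2 * (1 - α)) * B * (1 + ‖ξ‖) ^ N
        ≤ (C' * (1 + ‖ξ‖) ^ K) * B * (1 + ‖ξ‖) ^ N := by
          gcongr
          exact hK _ hR
      _ = C' * ((1 + ‖ξ‖) ^ (N + K) * B) := by rw [pow_add]; ring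
      _ ≤ C' * C := by
          gcongr
          exact hB x hx ξ hξ hR

theorem one_add_norm_le_two_mul {ξ η : Space d} {ε : ℝ} (hε : ε ≤ 1 / 2)
    (h : ‖η‖ ≤ ε * ‖ξ‖) : 1 + ‖ξ‖ ≤ 2 * (1 + ‖ξ + η‖) ∧ ‖ξ‖ / 2 ≤ ‖ξ + η‖ := by
  have h1 : ‖ξ‖ - ‖η‖ ≤ ‖ξ + η‖ := by
    simpa using norm_sub_norm_le ξ (-η)
  have h2 : ε * ‖ξ‖ ≤ 1 / 2 * ‖ξ‖ := by gcongr
  constructor <;> linarith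

/-- The average runs over displacements of size at most `2πr‖ξ‖ ^ (1 - α)`, eventually below `ε‖ξ‖`,
so it stays in the cone of decay. Position enters only through a unimodular factor, hence `U` is the
whole space. -/
theorem IsMicrolocallyRegularAt.isGaborRegularAt {α : ℝ} (hα : 0 < α) {φ : 𝓢(Space d, ℂ)}
    (hφ : IsAdmissibleWindow α φ) {u : 𝓢'(Space d, ℂ)} {x₀ ξ₀ : Space d}
    (h : IsMicrolocallyRegularAt (distribCLM u) x₀ ξ₀) : IsGaborRegularAt α φ u x₀ ξ₀ := by
  obtain ⟨Θ, Γ, R, h1, h2, h3, h4, h5⟩ := h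
  obtain ⟨r, hr, hsupp⟩ := hφ.exists_dualWindow_support
  obtain ⟨Γ', ε, hΓ', hξ₀, hε, hε2, hsub⟩ := h3.exists_smaller h4
  obtain ⟨R', hR'1, hR'⟩ := exists_mul_rpow_le hα (2 * Real.pi * r) hε
  refine (isGaborRegularAt_iff hα).2 ⟨Θ, Set.univ, Γ', max R' (2 * R), h1, h2, isOpen_univ,
    Set.mem_univ _, hΓ', hξ₀, lt_of_lt_of_le one_pos (hR'1.trans (le_max_left _ _)), fun N => ?_⟩
  obtain ⟨C, hC, hb⟩ := h5 N
  refine ⟨∫ s, ‖dualWindow φ s‖ * (2 ^ N * C),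
    integral_nonneg fun s => by positivity, fun x _ ξ hξ hR => ?_⟩
  refine mul_norm_integral_le (by positivity) ((dualWindow φ).integrable.norm.mul_const _)
    fun s => ?_
  rw [norm_mul, norm_mul, norm_osc, mul_one, mul_left_comm]
  by_cases hs : dualWindow φ s = 0
  · simp [hs]
  refine mul_le_mul_of_nonneg_left ?_ (norm_nonneg _)
  set μ := 2 * Real.pi * ‖ξ‖ ^ (1 - α)
  have hμs : ‖μ • s‖ ≤ ε * ‖ξ‖ := by
    rw [norm_smul, Real.norm_of_nonneg (by positivity)]
    calc μ * ‖s‖ ≤ μ * r := by gcongr; exact hsupp s hs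
      _ = 2 * Real.pi * r * ‖ξ‖ ^ (1 - α) := by ring
      _ ≤ ε * ‖ξ‖ := hR' _ ((le_max_left _ _).trans hR)
  obtain ⟨h6, h7⟩ := one_add_norm_le_two_mul hε2 hμs
  have hmem : ξ + μ • s ∈ Γ := hsub ξ hξ _ (by simpa using hμs)
  have hRle : R ≤ ‖ξ + μ • s‖ := by
    have := (le_max_right R' (2 * R)).trans hR
    linarith
  calc (1 + ‖ξ‖) ^ N * ‖freq (distribCLM u) Θ (ξ + μ • s)‖
      ≤ (2 * (1 + ‖ξ + μ • s‖)) ^ N * ‖freq (distribCLM u) Θ (ξ + μ • s)‖ := by gcongr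
    _ = 2 ^ N * ((1 + ‖ξ + μ • s‖) ^ N * ‖freq (distribCLM u) Θ (ξ + μ • s)‖) := by
        rw [mul_pow]; ring
    _ ≤ 2 ^ N * C := by
        gcongr
        exact hb _ hmem hRle

/-! ### Moments of compactly supported functions -/

theorem integral_mul_osc_eq {g : Space d → ℂ} (hg : Continuous g) (hc : HasCompactSupport g)
    (y : Space d) (M : ℕ) :
    ∫ s, g s * osc y s = ∑ k ∈ Finset.range M, ((k.factorial : ℂ)⁻¹) *
      (∫ s, g s * (-(Complex.I * (inner ℝ s y : ℝ))) ^ k) + ∫ s, g s * oscRemainder M y s := by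
  have hint : ∀ p : Space d → ℂ, Continuous p → Integrable fun s => g s * p s := fun p hp =>
    (hg.mul hp).integrable_of_hasCompactSupport hc.mul_right
  have hk : ∀ k : ℕ, Integrable fun s : Space d =>
      ((k.factorial : ℂ)⁻¹) * (g s * (-(Complex.I * (inner ℝ s y : ℝ))) ^ k) := fun k =>
    (hint _ (by fun_prop)).const_mul _
  simp_rw [← integral_const_mul]
  rw [← integral_finsetSum _ fun k _ => hk k, ← integral_add (integrable_finsetSum _ fun k _ => hk k)
    (hint _ (contDiff_oscRemainder M y).continuous)]
  refine integral_congr_ae (Filter.Eventually.of_forall fun s => ?_)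
  simp only [oscRemainder, expRemainder, osc, mul_sub, Finset.mul_sum]
  rw [add_comm, sub_add_eq_add_sub, eq_sub_iff_add_eq]
  congr 1
  refine Finset.sum_congr rfl fun k _ => ?_
  field_simp

/-- Only the Taylor remainder contributes, and it tends to zero by dominated convergence on the
compact support of `g`. -/
theorem integral_mul_osc_eq_zero_of_moments {g : Space d → ℂ} (hg : Continuous g)
    (hc : HasCompactSupport g) (y : Space d)
    (h : ∀ k : ℕ, ∫ s, g s * (-(Complex.I * (inner ℝ s y : ℝ))) ^ k = 0) :
    ∫ s, g s * osc y s = 0 := by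
  have heq : ∀ M : ℕ, ∫ s, g s * osc y s = ∫ s, g s * oscRemainder M y s := fun M => by
    rw [integral_mul_osc_eq hg hc y M]
    simp [h]
  have hlim : Filter.Tendsto (fun M : ℕ => ∫ s, g s * oscRemainder M y s) Filter.atTop
      (nhds (∫ _ : Space d, (0 : ℂ))) := by
    refine tendsto_integral_of_dominated_convergence
      (fun s => ‖g s‖ * Real.exp |inner ℝ s y|)
      (fun M => (hg.mul (contDiff_oscRemainder M y).continuous).aestronglyMeasurable) ?_
      (fun M => Filter.Eventually.of_forall fun s => ?_)
      (Filter.Eventually.of_forall fun s => ?_)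
    · exact Continuous.integrable_of_hasCompactSupport (by fun_prop) hc.norm.mul_right
    · rw [norm_mul]
      gcongr
      exact norm_expRemainder_le_exp M _
    · simpa [oscRemainder] using (tendsto_expRemainder (inner ℝ s y)).const_mul (g s)
  simp_rw [← heq] at hlim
  simpa using tendsto_nhds_unique hlim tendsto_const_nhds |>.symm

/-- Strong induction: once the lower moments vanish, the `k`-th Taylor term equals minus a remainder
of size `O(t ^ (k + 1))`; divide by `t ^ k` and let `t → 0`. -/
theorem moments_eq_zero_of_eventually {g : Space d → ℂ} (hg : Continuous g)
    (hc : HasCompactSupport g) (y : Space d) {ε : ℝ} (hε : 0 < ε)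
    (h : ∀ t : ℝ, 0 < t → t < ε → ∫ s, g s * osc (t • y) s = 0) (k : ℕ) :
    ∫ s, g s * (-(Complex.I * (inner ℝ s y : ℝ))) ^ k = 0 := by
  induction k using Nat.strong_induction_on with
  | _ k ih =>
    set m := ∫ s, g s * (-(Complex.I * (inner ℝ s y : ℝ))) ^ k
    set D := ∫ s, ‖g s‖ * |inner ℝ s y| ^ (k + 1)
    have key : ∀ t : ℝ, 0 < t → t < ε → ‖m‖ ≤ k.factorial * D * t := by
      intro t ht htε
      have hz := h t ht htε
      rw [integral_mul_osc_eq hg hc (t • y) (k + 1)] at hz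
      have hmom : ∀ j : ℕ, ∫ s, g s * (-(Complex.I * (inner ℝ s (t • y) : ℝ))) ^ j =
          (t : ℂ) ^ j * ∫ s, g s * (-(Complex.I * (inner ℝ s y : ℝ))) ^ j := fun j => by
        rw [← integral_const_mul]
        refine integral_congr_ae (Filter.Eventually.of_forall fun s => ?_)
        simp only [inner_smul_right]
        push_cast
        ring
      simp_rw [hmom] at hz
      rw [Finset.sum_range_succ, Finset.sum_eq_zero, zero_add] at hz
      swap
      · intro j hj
        rw [ih j (Finset.mem_range.1 hj)]
        simp
      have hrem : ‖∫ s, g s * oscRemainder (k + 1) (t • y) s‖ ≤ t ^ (k + 1) * D := by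
        rw [← integral_const_mul]
        refine norm_integral_le_of_norm_le ?_ (Filter.Eventually.of_forall fun s => ?_)
        · exact (Continuous.integrable_of_hasCompactSupport (by fun_prop)
            hc.norm.mul_right).const_mul _
        · rw [norm_mul, mul_left_comm, ← mul_pow]
          gcongr
          refine (norm_expRemainder_le _ _).trans (le_of_eq ?_)
          rw [inner_smul_right, abs_mul, abs_of_pos ht]
      rw [eq_neg_of_add_eq_zero_right hz, norm_neg, norm_mul, norm_mul, norm_inv, norm_pow,
        Complex.norm_real, Real.norm_of_nonneg ht.le, Complex.norm_natCast] at hrem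
      have hf : (0 : ℝ) < k.factorial := by exact_mod_cast k.factorial_pos
      have htk : 0 < t ^ k := by positivity
      have h2 : t ^ k * ‖m‖ ≤ t ^ k * (k.factorial * D * t) := by
        calc t ^ k * ‖m‖ = k.factorial * ((k.factorial : ℝ)⁻¹ * (t ^ k * ‖m‖)) := by field_simp
          _ ≤ k.factorial * (t ^ (k + 1) * D) := by gcongr
          _ = _ := by ring
      exact le_of_mul_le_mul_left h2 htk
    have hle : ‖m‖ ≤ 0 := by
      have hlim : Filter.Tendsto (fun t : ℝ => k.factorial * D * t) (nhdsWithin 0 (Set.Ioi 0))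
          (nhds 0) := by
        have : Continuous fun t : ℝ => k.factorial * D * t := by fun_prop
        simpa using (this.tendsto 0).mono_left nhdsWithin_le_nhds
      refine ge_of_tendsto hlim ?_
      filter_upwards [Ioo_mem_nhdsGT hε] with t ht
      exact key t ht.1 ht.2
    exact norm_le_zero_iff.1 hle

theorem hasCompactSupport_of_norm_le {ψ : Space d → ℂ} {r : ℝ}
    (h : ∀ s, ψ s ≠ 0 → ‖s‖ ≤ r) : HasCompactSupport ψ :=
  HasCompactSupport.intro (isCompact_closedBall (0 : Space d) r) fun s hs => by
    by_contra h0
    exact hs (by simpa using h s h0)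

/-- A band-limited function that vanishes on a nonempty open set is zero. -/
theorem exists_mem_ne_zero_of_isOpen {φ : 𝓢(Space d, ℂ)} (hφ : φ ≠ 0)
    (hc : HasCompactSupport (dualWindow φ)) {V : Set (Space d)} (hV : IsOpen V)
    (hne : V.Nonempty) : ∃ s ∈ V, φ s ≠ 0 := by
  by_contra! hzero
  obtain ⟨s₀, hs₀⟩ := hne
  obtain ⟨δ, hδ, hball⟩ := Metric.isOpen_iff.1 hV s₀ hs₀
  apply hφ
  ext w
  have hval : ∀ w : Space d, (starRingEnd ℂ) (φ w) =
      ∫ s, dualWindow φ s * osc ((2 * Real.pi) • s) w := fun w => by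
    have := fourier_smul_eq_integral (dualWindow φ) 1 w
    rwa [one_smul, mul_one, fourier_dualWindow, conjSchwartz_apply] at this
  set g : Space d → ℂ := fun s => dualWindow φ s * osc ((2 * Real.pi) • s) s₀
  have hg : Continuous g := (dualWindow φ).continuous.mul
    ((continuous_osc_left s₀).comp (continuous_const_smul _))
  have hgc : HasCompactSupport g := hc.mul_right
  set y := (2 * Real.pi) • (w - s₀)
  -- Analytic continuation along the line from `s₀` to `w`: vanishing for small `t` kills all
  -- moments of `g` in direction `y`, and these determine the value at `t = 1`.
  have hline : ∀ t : ℝ, ∫ s, g s * osc (t • y) s =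
      (starRingEnd ℂ) (φ (s₀ + t • (w - s₀))) := fun t => by
    rw [hval]
    refine integral_congr_ae (Filter.Eventually.of_forall fun s => ?_)
    simp only [g, y, osc, mul_assoc, ← Complex.exp_add, inner_smul_right, inner_add_left,
      inner_smul_left, real_inner_comm (w - s₀) s]
    congr 2
    simp only [conj_trivial]
    push_cast
    ring
  have hmom := moments_eq_zero_of_eventually hg hgc y (ε := δ / (1 + ‖w - s₀‖)) (by positivity)
    (fun t ht htε => by
      rw [hline, hzero _ (hball ?_), map_zero]
      rw [Metric.mem_ball, dist_eq_norm, add_sub_cancel_left, norm_smul, Real.norm_of_nonneg ht.le]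
      rw [lt_div_iff₀ (by positivity)] at htε
      nlinarith [norm_nonneg (w - s₀)])
  have := integral_mul_osc_eq_zero_of_moments hg hgc y hmom
  rw [← one_smul ℝ y, hline, one_smul, add_sub_cancel] at this
  simpa using this

/-! ### Cut-offs -/

/-- The product of a smooth bump function and a Schwartz function. -/
def bumpMul {x₀ : Space d} (b : ContDiffBump x₀) (f : 𝓢(Space d, ℂ)) : 𝓢(Space d, ℂ) :=
  HasCompactSupport.toSchwartzMap (f := fun t => ((b t : ℝ) : ℂ) * f t)
    (b.hasCompactSupport.comp_left (g := Complex.ofReal) Complex.ofReal_zero).mul_right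
    ((Complex.ofRealCLM.contDiff.comp b.contDiff).mul (f.smooth ⊤))

theorem bumpMul_apply {x₀ : Space d} (b : ContDiffBump x₀) (f : 𝓢(Space d, ℂ)) (t : Space d) :
    bumpMul b f t = ((b t : ℝ) : ℂ) * f t := rfl

theorem hasCompactSupport_bumpMul {x₀ : Space d} (b : ContDiffBump x₀) (f : 𝓢(Space d, ℂ)) :
    HasCompactSupport (bumpMul b f) :=
  (b.hasCompactSupport.comp_left (g := Complex.ofReal) Complex.ofReal_zero).mul_right

/-- A smooth bump function as a complex Schwartz function. -/
def bumpSchwartz {x₀ : Space d} (b : ContDiffBump x₀) : 𝓢(Space d, ℂ) :=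
  HasCompactSupport.toSchwartzMap (f := fun t => ((b t : ℝ) : ℂ))
    (b.hasCompactSupport.comp_left (g := Complex.ofReal) Complex.ofReal_zero)
    (Complex.ofRealCLM.contDiff.comp b.contDiff)

theorem bumpSchwartz_apply {x₀ : Space d} (b : ContDiffBump x₀) (t : Space d) :
    bumpSchwartz b t = ((b t : ℝ) : ℂ) := rfl

/-- Take a bump supported where `h` does not vanish and divide by `h`: the quotient is smooth, with
compact support. -/
theorem exists_bump_div {h : Space d → ℂ} (hh : ContDiff ℝ ∞ h) {x₀ : Space d} (h0 : h x₀ ≠ 0) :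
    ∃ (b : ContDiffBump x₀) (κ : 𝓢(Space d, ℂ)), ∀ t, κ t * h t = ((b t : ℝ) : ℂ) := by
  have hopen : IsOpen {t | h t ≠ 0} := isOpen_ne_fun hh.continuous continuous_const
  obtain ⟨δ, hδ, hball⟩ := Metric.isOpen_iff.1 hopen x₀ h0
  let b : ContDiffBump x₀ := ⟨δ / 4, δ / 2, by linarith, by linarith⟩
  have hbs : ∀ t ∈ tsupport (fun t => ((b t : ℝ) : ℂ)), h t ≠ 0 := by
    intro t ht
    have h1 : t ∈ tsupport b := tsupport_comp_subset (g := Complex.ofReal) Complex.ofReal_zero b ht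
    rw [b.tsupport_eq] at h1
    exact hball (Metric.closedBall_subset_ball (by change δ / 2 < δ; linarith) h1)
  have hcs : HasCompactSupport fun t => ((b t : ℝ) : ℂ) :=
    b.hasCompactSupport.comp_left (g := Complex.ofReal) Complex.ofReal_zero
  have hbd : ContDiff ℝ ∞ fun t => ((b t : ℝ) : ℂ) := Complex.ofRealCLM.contDiff.comp b.contDiff
  have hsm : ContDiff ℝ ∞ fun t => ((b t : ℝ) : ℂ) * (h t)⁻¹ := by
    refine contDiff_iff_contDiffAt.2 fun t => ?_
    by_cases ht : t ∈ tsupport (fun t => ((b t : ℝ) : ℂ))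
    · exact hbd.contDiffAt.mul (hh.contDiffAt.inv (hbs t ht))
    · have hev : (fun t => ((b t : ℝ) : ℂ) * (h t)⁻¹) =ᶠ[nhds t] fun _ => 0 := by
        filter_upwards [notMem_tsupport_iff_eventuallyEq.1 ht] with s hs
        rw [hs]
        simp
      exact contDiffAt_const.congr_of_eventuallyEq hev
  refine ⟨b, hcs.mul_right.toSchwartzMap hsm, fun t => ?_⟩
  change ((b t : ℝ) : ℂ) * (h t)⁻¹ * h t = _
  by_cases ht : h t = 0
  · have : t ∉ tsupport (fun t => ((b t : ℝ) : ℂ)) := fun hmem => hbs t hmem ht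
    have h2 : ((b t : ℝ) : ℂ) = 0 := image_eq_zero_of_notMem_tsupport
      (f := fun t => ((b t : ℝ) : ℂ)) this
    rw [h2]
    simp
  · rw [inv_mul_cancel_right₀ ht]

theorem freq_eq_averagedFreq_of_fourierInv (u : 𝓢(Space d, ℂ) →L[ℂ] ℂ) (Θ f ρ : 𝓢(Space d, ℂ))
    (hf : ∀ t, f t = ρ t * Θ t) (ξ : Space d) :
    freq u f ξ = averagedFreq u Θ (𝓕⁻ ρ) (2 * Real.pi) 0 ξ := by
  refine freq_eq_integral u Θ _ f _ 0 ξ fun t => ?_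
  have := fourier_smul_eq_integral (𝓕⁻ ρ) 1 t
  rw [one_smul, mul_one, FourierTransform.fourier_fourierInv_eq] at this
  rw [sub_zero, ← this, hf]

/-! ### The case of packets of unit width -/

/-- For `‖μ • s‖ ≤ ε‖ξ‖` the shifted frequency lies in the cone of decay. Otherwise `1 + ‖ξ‖` is
controlled by `1 + ‖s‖`, and the decay of `κ` pays both for the weight and for the polynomial growth
of `freq`. -/
theorem exists_conic_convolution_bound (u : 𝓢(Space d, ℂ) →L[ℂ] ℂ) (Θ κ : 𝓢(Space d, ℂ))
    {Γ Γ' : Set (Space d)} {R ε : ℝ}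
    (hΓ : ∀ N : ℕ, ∃ C : ℝ, 0 ≤ C ∧ ∀ ξ ∈ Γ, R ≤ ‖ξ‖ → (1 + ‖ξ‖) ^ N * ‖freq u Θ ξ‖ ≤ C)
    (hε : 0 < ε) (hε2 : ε ≤ 1 / 2) (hsub : ∀ ξ ∈ Γ', ∀ η, ‖η - ξ‖ ≤ ε * ‖ξ‖ → η ∈ Γ)
    (μ : ℝ) (x : Space d) (N : ℕ) :
    ∃ C : ℝ, 0 ≤ C ∧ ∀ ξ ∈ Γ', 2 * R ≤ ‖ξ‖ →
      (1 + ‖ξ‖) ^ N * ‖averagedFreq u Θ κ μ x ξ‖ ≤ C := by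
  obtain ⟨C₀, K, hC₀, hgrow⟩ := exists_freq_bound u Θ
  obtain ⟨C, hC, hdec⟩ := hΓ N
  set D := 2 ^ N * C + (1 + |μ| / ε) ^ (N + K) * C₀ * (1 + |μ|) ^ K with hD
  have hD0 : 0 ≤ D := by positivity
  refine ⟨∫ s, D * ((1 + ‖s‖) ^ (N + K + K) * ‖κ s‖),
    integral_nonneg fun s => by positivity, fun ξ hξ hR => ?_⟩
  refine mul_norm_integral_le (by positivity)
    ((integrable_one_add_norm_pow_mul κ _).const_mul D) fun s => ?_
  rw [norm_mul, norm_mul, norm_osc, mul_one]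
  suffices h : (1 + ‖ξ‖) ^ N * ‖freq u Θ (ξ + μ • s)‖ ≤ D * (1 + ‖s‖) ^ (N + K + K) by
    calc (1 + ‖ξ‖) ^ N * (‖κ s‖ * ‖freq u Θ (ξ + μ • s)‖)
        = ‖κ s‖ * ((1 + ‖ξ‖) ^ N * ‖freq u Θ (ξ + μ • s)‖) := by ring
      _ ≤ ‖κ s‖ * (D * (1 + ‖s‖) ^ (N + K + K)) := by gcongr
      _ = _ := by ring
  have hone : 1 ≤ (1 + ‖s‖) ^ (N + K + K) := one_le_pow₀ (by simp)
  rcases le_or_gt ‖μ • s‖ (ε * ‖ξ‖) with hle | hgt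
  · obtain ⟨h1, h2⟩ := one_add_norm_le_two_mul hε2 hle
    have hmem : ξ + μ • s ∈ Γ := hsub ξ hξ _ (by simpa using hle)
    calc (1 + ‖ξ‖) ^ N * ‖freq u Θ (ξ + μ • s)‖
        ≤ (2 * (1 + ‖ξ + μ • s‖)) ^ N * ‖freq u Θ (ξ + μ • s)‖ := by gcongr
      _ = 2 ^ N * ((1 + ‖ξ + μ • s‖) ^ N * ‖freq u Θ (ξ + μ • s)‖) := by rw [mul_pow]; ring
      _ ≤ 2 ^ N * C := by
          gcongr
          exact hdec _ hmem (by linarith)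
      _ ≤ D := le_add_of_nonneg_right (by positivity)
      _ ≤ _ := le_mul_of_one_le_right hD0 hone
  · have h1 : 1 + ‖ξ‖ ≤ (1 + |μ| / ε) * (1 + ‖s‖) := by
      rw [norm_smul, Real.norm_eq_abs] at hgt
      have h2 : ‖ξ‖ ≤ |μ| / ε * ‖s‖ := by
        rw [div_mul_eq_mul_div, le_div_iff₀ hε]
        linarith
      have h3 : 0 ≤ |μ| / ε := by positivity
      nlinarith [norm_nonneg s]
    calc (1 + ‖ξ‖) ^ N * ‖freq u Θ (ξ + μ • s)‖
        ≤ (1 + ‖ξ‖) ^ N * (C₀ * ((1 + ‖ξ‖) * ((1 + |μ|) * (1 + ‖s‖))) ^ K) := by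
          gcongr
          refine (hgrow _).trans ?_
          gcongr
          exact (one_add_norm_add_le _ _).trans (by gcongr; exact one_add_norm_smul_le _ _)
      _ = (1 + ‖ξ‖) ^ (N + K) * (C₀ * ((1 + |μ|) * (1 + ‖s‖)) ^ K) := by
          rw [mul_pow (1 + ‖ξ‖), pow_add]; ring
      _ ≤ ((1 + |μ| / ε) * (1 + ‖s‖)) ^ (N + K) * (C₀ * ((1 + |μ|) * (1 + ‖s‖)) ^ K) := by
          gcongr
      _ = ((1 + |μ| / ε) ^ (N + K) * C₀ * (1 + |μ|) ^ K) * (1 + ‖s‖) ^ (N + K + K) := by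
          rw [mul_pow, mul_pow, pow_add (1 + ‖s‖) (N + K)]; ring
      _ ≤ D * (1 + ‖s‖) ^ (N + K + K) := by
          gcongr
          exact le_add_of_nonneg_left (by positivity)

theorem AveragesDecay.isMicrolocallyRegularAt_of_eq_one {φ Θ : 𝓢(Space d, ℂ)} (hφ : φ ≠ 0)
    (hψ : HasCompactSupport (dualWindow φ)) {u : 𝓢(Space d, ℂ) →L[ℂ] ℂ} {x₀ ξ₀ : Space d}
    {U Γ : Set (Space d)} {R : ℝ} (hΘ : HasCompactSupport Θ) (hΘ0 : Θ x₀ ≠ 0) (hU : IsOpen U)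
    (hx₀ : x₀ ∈ U) (hΓ : IsOpenCone Γ) (hξ₀ : ξ₀ ∈ Γ)
    (h : AveragesDecay 1 (dualWindow φ) u Θ U Γ R) : IsMicrolocallyRegularAt u x₀ ξ₀ := by
  -- This selects a centre `x₁ = x₀ - s₁` in `U` whose translated window does not vanish at `x₀`.
  obtain ⟨s₁, hs₁, hφs⟩ := exists_mem_ne_zero_of_isOpen hφ hψ
    (hU.preimage (continuous_const.sub continuous_id) : IsOpen ((fun s => x₀ - s) ⁻¹' U))
    ⟨0, by simpa using hx₀⟩
  obtain ⟨Γ', ε, hΓ', hξ₀', hε, hε2, hsub⟩ := hΓ.exists_smaller hξ₀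
  set x₁ := x₀ - s₁
  set f := localizedWindow φ Θ hΘ 1 x₁ with hf
  obtain ⟨b, ρ, hρ⟩ := exists_bump_div (h := fun t => conjSchwartz φ (t - x₁))
    (((conjSchwartz φ).smooth ⊤).comp (contDiff_id.sub contDiff_const)) (x₀ := x₀)
    (by simpa [x₁] using hφs)
  have hfreq : ∀ N : ℕ, ∃ C : ℝ, 0 ≤ C ∧ ∀ ξ ∈ Γ, R ≤ ‖ξ‖ → (1 + ‖ξ‖) ^ N * ‖freq u f ξ‖ ≤ C := by
    intro N
    obtain ⟨C, hC, hb⟩ := h N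
    refine ⟨C, hC, fun ξ hξ hR => ?_⟩
    have := hb x₁ hs₁ ξ hξ hR
    rwa [sub_self, Real.rpow_zero, ← freq_localizedWindow φ Θ hΘ] at this
  refine ⟨bumpMul b Θ, Γ', 2 * R, hasCompactSupport_bumpMul b Θ, ?_, hΓ', hξ₀', fun N => ?_⟩
  · rw [bumpMul_apply, b.one_of_mem_closedBall (Metric.mem_closedBall_self b.rIn_pos.le)]
    simpa using hΘ0
  · obtain ⟨C, hC, hb⟩ := exists_conic_convolution_bound u f (𝓕⁻ ρ) hfreq hε hε2 hsub
      (2 * Real.pi) 0 N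
    refine ⟨C, hC, fun ξ hξ hR => ?_⟩
    rw [freq_eq_averagedFreq_of_fourierInv u f _ ρ fun t => ?_]
    · exact hb ξ hξ hR
    · rw [bumpMul_apply, ← hρ, hf, localizedWindow_apply, one_smul, conjSchwartz_apply, mul_assoc]

/-! ### The case of shrinking packets -/

/-- Set `ξ = ζ - (2π t ^ (1 - α)) • w` and solve `‖ξ‖ = t` by the intermediate value theorem between
`‖ζ‖ / 2` and `2‖ζ‖`. The margin `ε / 2` is taken because `t` may reach `2‖ζ‖`. -/
theorem exists_preimage_in_cone {α : ℝ} (hα : 0 < α) (w : Space d) {Γ Γ' : Set (Space d)} {ε : ℝ}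
    (hε : 0 < ε) (hε2 : ε ≤ 1 / 2) (hsub : ∀ ξ ∈ Γ', ∀ η, ‖η - ξ‖ ≤ ε * ‖ξ‖ → η ∈ Γ) :
    ∃ R : ℝ, ∀ ζ ∈ Γ', R ≤ ‖ζ‖ → ∃ ξ ∈ Γ, ‖ζ‖ / 2 ≤ ‖ξ‖ ∧
      ξ + (2 * Real.pi * ‖ξ‖ ^ (1 - α)) • w = ζ := by
  obtain ⟨R₀, hR₀, hle⟩ := exists_mul_rpow_le hα (2 * Real.pi * ‖w‖) (half_pos hε)
  refine ⟨2 * R₀, fun ζ hζ hR => ?_⟩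
  set f : ℝ → ℝ := fun t => ‖ζ - (2 * Real.pi * t ^ (1 - α)) • w‖ - t
  have hζ0 : 0 < ‖ζ‖ := by linarith
  have hnorm : ∀ t, R₀ ≤ t → ‖(2 * Real.pi * t ^ (1 - α)) • w‖ ≤ ε / 2 * t := fun t ht => by
    have ht0 : 0 < t := by linarith
    rw [norm_smul, Real.norm_of_nonneg (by positivity)]
    calc _ = 2 * Real.pi * ‖w‖ * t ^ (1 - α) := by ring
      _ ≤ _ := hle t ht
  have hcont : ContinuousOn f (Set.Icc (‖ζ‖ / 2) (2 * ‖ζ‖)) := by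
    have h1 : ContinuousOn (fun t : ℝ => t ^ (1 - α)) (Set.Icc (‖ζ‖ / 2) (2 * ‖ζ‖)) :=
      continuousOn_id.rpow_const fun t ht => Or.inl (by
        have := ht.1
        simp only [id]
        linarith)
    exact ((continuousOn_const.sub ((continuousOn_const.mul h1).smul continuousOn_const)).norm).sub
      continuousOn_id
  have hlow : 0 ≤ f (‖ζ‖ / 2) := by
    have h1 := hnorm (‖ζ‖ / 2) (by linarith)
    have h2 := norm_sub_norm_le ζ ((2 * Real.pi * (‖ζ‖ / 2) ^ (1 - α)) • w)
    simp only [f]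
    nlinarith
  have hhigh : f (2 * ‖ζ‖) ≤ 0 := by
    have h1 := hnorm (2 * ‖ζ‖) (by linarith)
    have h2 := norm_sub_le ζ ((2 * Real.pi * (2 * ‖ζ‖) ^ (1 - α)) • w)
    simp only [f]
    nlinarith
  obtain ⟨t, ht, hft⟩ := intermediate_value_Icc' (by linarith) hcont ⟨hhigh, hlow⟩
  set ξ := ζ - (2 * Real.pi * t ^ (1 - α)) • w
  have hξt : ‖ξ‖ = t := by
    simp only [f] at hft
    linarith
  refine ⟨ξ, hsub ζ hζ ξ ?_, by rw [hξt]; exact ht.1, by rw [hξt]; simp [ξ]⟩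
  rw [sub_sub_cancel_left, norm_neg]
  refine (hnorm t (by linarith [ht.1])).trans ?_
  nlinarith [ht.2]

/-- Converts powers of the frequency into powers of the scale `r ^ β`, so decay measured at that
scale is rapid in the frequency. -/
theorem exists_one_add_pow_le {β : ℝ} (hβ : 0 < β) (p : ℕ) :
    ∃ L : ℕ, ∀ r : ℝ, 1 ≤ r → (1 + r) ^ p ≤ 2 ^ p * (r ^ β) ^ L := by
  refine ⟨⌈(p : ℝ) / β⌉₊, fun r hr => ?_⟩
  have hr0 : 0 < r := by linarith
  have h1 : r ^ p ≤ (r ^ β) ^ ⌈(p : ℝ) / β⌉₊ := by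
    rw [← Real.rpow_natCast, ← Real.rpow_natCast, ← Real.rpow_mul hr0.le]
    refine Real.rpow_le_rpow_of_exponent_le hr ?_
    have := Nat.le_ceil ((p : ℝ) / β)
    rw [div_le_iff₀ hβ] at this
    linarith
  calc (1 + r) ^ p ≤ (2 * r) ^ p := by gcongr; linarith
    _ = 2 ^ p * r ^ p := mul_pow _ _ _
    _ ≤ _ := by gcongr

theorem rpow_one_sub_le_self {α r : ℝ} (hα : 0 ≤ α) (hr : 1 ≤ r) : r ^ (1 - α) ≤ r := by
  calc r ^ (1 - α) ≤ r ^ (1 : ℝ) := Real.rpow_le_rpow_of_exponent_le hr (by linarith)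
    _ = r := Real.rpow_one r

/-- A crude bound, uniform in `x`, for positions outside the set where decay is known. -/
theorem exists_averagedFreq_bound {α : ℝ} (hα : 0 ≤ α) (u : 𝓢(Space d, ℂ) →L[ℂ] ℂ)
    (Θ ψ : 𝓢(Space d, ℂ)) :
    ∃ (C : ℝ) (K : ℕ), 0 ≤ C ∧ ∀ x ξ : Space d, 1 ≤ ‖ξ‖ →
      ‖averagedFreq u Θ ψ (2 * Real.pi * ‖ξ‖ ^ (1 - α)) x ξ‖ ≤ C * (1 + ‖ξ‖) ^ K := by
  obtain ⟨C₀, K, hC₀, hgrow⟩ := exists_freq_bound u Θ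
  set c := 1 + 2 * Real.pi
  have hc : 0 ≤ c := by positivity
  refine ⟨∫ s, C₀ * c ^ K * ((1 + ‖s‖) ^ K * ‖ψ s‖), K + K,
    integral_nonneg fun s => by positivity, fun x ξ hξ => ?_⟩
  have hpos : 0 < (1 + ‖ξ‖) ^ (K + K) := by positivity
  rw [← integral_mul_const]
  refine norm_integral_le_of_norm_le
    (((integrable_one_add_norm_pow_mul ψ K).const_mul _).mul_const _)
    (Filter.Eventually.of_forall fun s => ?_)
  rw [norm_mul, norm_mul, norm_osc, mul_one]
  have hμ : 1 + |2 * Real.pi * ‖ξ‖ ^ (1 - α)| ≤ c * (1 + ‖ξ‖) := by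
    rw [abs_of_nonneg (by positivity)]
    have := rpow_one_sub_le_self hα hξ
    have hpi : 0 < 2 * Real.pi := by positivity
    nlinarith
  calc ‖ψ s‖ * ‖freq u Θ (ξ + (2 * Real.pi * ‖ξ‖ ^ (1 - α)) • s)‖
      ≤ ‖ψ s‖ * (C₀ * ((1 + ‖ξ‖) * ((c * (1 + ‖ξ‖)) * (1 + ‖s‖))) ^ K) := by
        gcongr
        refine (hgrow _).trans ?_
        gcongr
        refine (one_add_norm_add_le _ _).trans ?_
        gcongr
        exact (one_add_norm_smul_le _ _).trans (by gcongr)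
    _ = _ := by
        rw [mul_pow, mul_pow, mul_pow, pow_add]
        ring

theorem integrable_mul_freq (u : 𝓢(Space d, ℂ) →L[ℂ] ℂ) (Θ : 𝓢(Space d, ℂ)) {ψ : Space d → ℂ}
    (hψc : Continuous ψ) (hψ : HasCompactSupport ψ) (μ : ℝ) (ξ : Space d) :
    Integrable fun s => ψ s * freq u Θ (ξ + μ • s) :=
  (hψc.mul ((continuous_freq u Θ).comp (by fun_prop))).integrable_of_hasCompactSupport
    hψ.mul_right

/-- A localized average of the Fourier transform as a superposition of the averages
`averagedFreq`. -/
theorem integral_mul_fourierInv_eq (u : 𝓢(Space d, ℂ) →L[ℂ] ℂ) (Θ κ β ψ : 𝓢(Space d, ℂ))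
    (hψ : HasCompactSupport ψ) {c : ℝ} (hc : 0 < c) (w ξ : Space d) :
    ∫ s, κ s * ψ s * freq u Θ (ξ + (2 * Real.pi * c) • s) * (𝓕⁻ β) (c • (s - w)) =
      ∫ p : Space d × Space d, (𝓕 κ) p.1 * β p.2 * osc ((2 * Real.pi * c) • w) p.2 *
        averagedFreq u Θ ψ (2 * Real.pi * c) (p.2 + c⁻¹ • p.1) ξ := by
  set μ := 2 * Real.pi * c
  -- The common integrand for Fubini: integration in `s` gives `averagedFreq`, while integration in
  -- `p` factors into the inverse transforms giving `κ s` and the concentrated kernel.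
  set G : Space d × Space d → Space d → ℂ := fun p s =>
    ((𝓕 κ) p.1 * β p.2) * (ψ s * freq u Θ (ξ + μ • s)) *
      (osc (μ • w) p.2 * osc (μ • s) (-(p.2 + c⁻¹ • p.1)))
  have hG : Integrable (Function.uncurry G)
      ((volume : Measure (Space d × Space d)).prod (volume : Measure (Space d))) := by
    have h1 : Integrable (fun p : Space d × Space d => (𝓕 κ) p.1 * β p.2) :=
      (𝓕 κ).integrable.mul_prod β.integrable
    refine (h1.mul_prod (integrable_mul_freq u Θ ψ.continuous hψ μ ξ)).mul_bdd (c := 1)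
      (Continuous.aestronglyMeasurable ?_) (Filter.Eventually.of_forall fun z => ?_)
    · unfold osc
      fun_prop
    · simp
  have hswap := integral_integral_swap hG
  have hR : ∀ p : Space d × Space d, (𝓕 κ) p.1 * β p.2 * osc (μ • w) p.2 *
      averagedFreq u Θ ψ μ (p.2 + c⁻¹ • p.1) ξ = ∫ s, G p s := fun p => by
    unfold averagedFreq
    rw [← integral_const_mul]
    refine integral_congr_ae (Filter.Eventually.of_forall fun s => ?_)
    simp only [G]
    ring
  simp_rw [hR]
  rw [hswap]
  refine integral_congr_ae (Filter.Eventually.of_forall fun s => ?_)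
  have hκ : κ s = ∫ y, (𝓕 κ) y * Complex.exp (((2 * Real.pi * inner ℝ y s : ℝ) : ℂ) * Complex.I) := by
    have h1 : κ s = (𝓕⁻ (𝓕 κ)) s := by rw [FourierTransform.fourierInv_fourier_eq]
    rw [h1, SchwartzMap.fourierInv_coe, Real.fourierInv_eq']
    simp only [smul_eq_mul]
    refine integral_congr_ae (Filter.Eventually.of_forall fun y => ?_)
    simp only
    rw [mul_comm]
  have hβ : (𝓕⁻ β) (c • (s - w)) =
      ∫ x, β x * Complex.exp (((2 * Real.pi * inner ℝ x (c • (s - w)) : ℝ) : ℂ) * Complex.I) := by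
    rw [SchwartzMap.fourierInv_coe, Real.fourierInv_eq']
    simp only [smul_eq_mul]
    refine integral_congr_ae (Filter.Eventually.of_forall fun y => ?_)
    simp only
    rw [mul_comm]
  have hprod : κ s * (𝓕⁻ β) (c • (s - w)) = ∫ p : Space d × Space d,
      ((𝓕 κ) p.1 * Complex.exp (((2 * Real.pi * inner ℝ p.1 s : ℝ) : ℂ) * Complex.I)) *
      (β p.2 * Complex.exp (((2 * Real.pi * inner ℝ p.2 (c • (s - w)) : ℝ) : ℂ) * Complex.I)) := by
    rw [hκ, hβ]
    exact (integral_prod_mul _ _).symm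
  calc κ s * ψ s * freq u Θ (ξ + μ • s) * (𝓕⁻ β) (c • (s - w))
      = (ψ s * freq u Θ (ξ + μ • s)) * (κ s * (𝓕⁻ β) (c • (s - w))) := by ring
    _ = _ := by
      rw [hprod, ← integral_const_mul]
      refine integral_congr_ae (Filter.Eventually.of_forall fun p => ?_)
      simp only [G]
      have hexp : Complex.exp (((2 * Real.pi * inner ℝ p.1 s : ℝ) : ℂ) * Complex.I) *
          Complex.exp (((2 * Real.pi * inner ℝ p.2 (c • (s - w)) : ℝ) : ℂ) * Complex.I) =
          osc (μ • w) p.2 * osc (μ • s) (-(p.2 + c⁻¹ • p.1)) := by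
        simp only [osc, ← Complex.exp_add, μ, inner_smul_right, inner_sub_right, inner_neg_left,
          inner_add_left, inner_smul_left, conj_trivial]
        congr 1
        have : (c : ℂ) ≠ 0 := by exact_mod_cast hc.ne'
        push_cast
        field_simp
        ring
      rw [← hexp]
      ring

/-- Multiplication by `κ` perturbs positions by `p.1` at scale `‖ξ‖ ^ (α - 1)`. Small perturbations
of the support of `b` stay in `U`; large ones force `‖p.1‖` to exceed a multiple of `‖ξ‖ ^ (1 - α)`,
where the decay of `𝓕 κ` beats the crude bound. -/
theorem AveragesDecay.exists_localized_bound {α : ℝ} (hα : 0 < α) (hα1 : α < 1)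
    {u : 𝓢(Space d, ℂ) →L[ℂ] ℂ} {Θ ψ : 𝓢(Space d, ℂ)} (hψ : HasCompactSupport ψ)
    {U Γ : Set (Space d)} {R : ℝ} (h : AveragesDecay α ψ u Θ U Γ R) (κ : 𝓢(Space d, ℂ))
    {x₀ : Space d} (b : ContDiffBump x₀) (hb : Metric.ball x₀ (2 * b.rOut) ⊆ U) (w : Space d)
    (N : ℕ) :
    ∃ C : ℝ, 0 ≤ C ∧ ∀ ξ ∈ Γ, R ≤ ‖ξ‖ → 1 ≤ ‖ξ‖ →
      (1 + ‖ξ‖) ^ N * ‖∫ s, κ s * ψ s * freq u Θ (ξ + (2 * Real.pi * ‖ξ‖ ^ (1 - α)) • s) *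
        (𝓕⁻ (bumpSchwartz b)) (‖ξ‖ ^ (1 - α) • (s - w))‖ ≤ C := by
  obtain ⟨C₁, hC₁, hdec⟩ := h N
  obtain ⟨C₂, K, hC₂, hgrow⟩ := exists_averagedFreq_bound hα.le u Θ ψ
  obtain ⟨L, hL⟩ := exists_one_add_pow_le (sub_pos.2 hα1) (N + K)
  have hrO : 0 < b.rOut := b.rOut_pos
  set D := C₁ + C₂ * (2 ^ (N + K) * (1 / b.rOut) ^ L)
  have hD : 0 ≤ D := by positivity
  have hint : Integrable fun p : Space d × Space d =>
      ((1 + ‖p.1‖) ^ L * ‖(𝓕 κ) p.1‖) * ‖bumpSchwartz b p.2‖ :=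
    (integrable_one_add_norm_pow_mul (𝓕 κ) L).mul_prod (bumpSchwartz b).integrable.norm
  refine ⟨∫ p : Space d × Space d,
    D * (((1 + ‖p.1‖) ^ L * ‖(𝓕 κ) p.1‖) * ‖bumpSchwartz b p.2‖),
    integral_nonneg fun p => by positivity, fun ξ hξ hR hξ1 => ?_⟩
  have hξ0 : 0 < ‖ξ‖ := by linarith
  have hc : 0 < ‖ξ‖ ^ (1 - α) := by positivity
  rw [integral_mul_fourierInv_eq u Θ κ (bumpSchwartz b) ψ hψ hc]
  refine mul_norm_integral_le (by positivity) (hint.const_mul D) fun p => ?_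
  rw [norm_mul, norm_mul, norm_mul, norm_osc, mul_one]
  by_cases hp : bumpSchwartz b p.2 = 0
  · simp [hp]
  have hp2 : ‖p.2 - x₀‖ < b.rOut := by
    by_contra! hle
    refine hp ?_
    rw [bumpSchwartz_apply, b.zero_of_le_dist (by rwa [dist_eq_norm]), Complex.ofReal_zero]
  set B := ‖averagedFreq u Θ ψ (2 * Real.pi * ‖ξ‖ ^ (1 - α)) (p.2 + (‖ξ‖ ^ (1 - α))⁻¹ • p.1) ξ‖
  suffices hB : (1 + ‖ξ‖) ^ N * B ≤ D * (1 + ‖p.1‖) ^ L by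
    calc (1 + ‖ξ‖) ^ N * (‖(𝓕 κ) p.1‖ * ‖bumpSchwartz b p.2‖ * B)
        = (‖(𝓕 κ) p.1‖ * ‖bumpSchwartz b p.2‖) * ((1 + ‖ξ‖) ^ N * B) := by ring
      _ ≤ (‖(𝓕 κ) p.1‖ * ‖bumpSchwartz b p.2‖) * (D * (1 + ‖p.1‖) ^ L) := by gcongr
      _ = _ := by ring
  have hone : 1 ≤ (1 + ‖p.1‖) ^ L := one_le_pow₀ (by simp)
  rcases lt_or_ge ‖(‖ξ‖ ^ (1 - α))⁻¹ • p.1‖ b.rOut with hlt | hge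
  · have hmem : p.2 + (‖ξ‖ ^ (1 - α))⁻¹ • p.1 ∈ U := by
      refine hb ?_
      rw [Metric.mem_ball, dist_eq_norm, add_sub_right_comm]
      refine (norm_add_le _ _).trans_lt ?_
      linarith
    calc _ ≤ C₁ := hdec _ hmem ξ hξ hR
      _ ≤ D := le_add_of_nonneg_right (by positivity)
      _ ≤ _ := le_mul_of_one_le_right hD hone
  · rw [norm_smul, norm_inv, Real.norm_of_nonneg hc.le, ← div_eq_inv_mul, le_div_iff₀ hc] at hge
    have hle : ‖ξ‖ ^ (1 - α) ≤ 1 / b.rOut * (1 + ‖p.1‖) := by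
      rw [one_div_mul_eq_div, le_div_iff₀ hrO]
      linarith
    calc (1 + ‖ξ‖) ^ N * B ≤ (1 + ‖ξ‖) ^ N * (C₂ * (1 + ‖ξ‖) ^ K) := by
          gcongr
          exact hgrow _ _ hξ1
      _ = C₂ * (1 + ‖ξ‖) ^ (N + K) := by rw [pow_add]; ring
      _ ≤ C₂ * (2 ^ (N + K) * (1 / b.rOut * (1 + ‖p.1‖)) ^ L) := by
          gcongr
          refine (hL _ hξ1).trans ?_
          gcongr
      _ = (C₂ * (2 ^ (N + K) * (1 / b.rOut) ^ L)) * (1 + ‖p.1‖) ^ L := by rw [mul_pow]; ring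
      _ ≤ D * (1 + ‖p.1‖) ^ L := by
          gcongr
          exact le_add_of_nonneg_left hC₁

theorem one_add_norm_add_rpow_smul_le {α : ℝ} (hα : 0 ≤ α) (w : Space d) {ξ : Space d}
    (hξ : 1 ≤ ‖ξ‖) :
    1 + ‖ξ + (2 * Real.pi * ‖ξ‖ ^ (1 - α)) • w‖ ≤ (1 + 2 * Real.pi * ‖w‖) * (1 + ‖ξ‖) := by
  have h1 : ‖(2 * Real.pi * ‖ξ‖ ^ (1 - α)) • w‖ ≤ 2 * Real.pi * ‖w‖ * ‖ξ‖ := by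
    rw [norm_smul, Real.norm_of_nonneg (by positivity)]
    have := rpow_one_sub_le_self hα hξ
    calc 2 * Real.pi * ‖ξ‖ ^ (1 - α) * ‖w‖ ≤ 2 * Real.pi * ‖ξ‖ * ‖w‖ := by gcongr
      _ = _ := by ring
  have h2 := norm_add_le ξ ((2 * Real.pi * ‖ξ‖ ^ (1 - α)) • w)
  have h3 : 0 ≤ 2 * Real.pi * ‖w‖ := by positivity
  nlinarith

/-- The factor `1 - b` vanishes for `‖s‖ ≤ b.rIn * ‖ξ‖ ^ (1 - α)`; beyond that, powers of `‖ξ‖` are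
bounded by powers of `1 + ‖s‖`, which `f` absorbs. -/
theorem exists_tail_bound {α : ℝ} (hα : 0 < α) (hα1 : α < 1) (u : 𝓢(Space d, ℂ) →L[ℂ] ℂ)
    (Θ f : 𝓢(Space d, ℂ)) {w : Space d} (b : ContDiffBump w) (N : ℕ) :
    ∃ C : ℝ, 0 ≤ C ∧ ∀ ξ : Space d, 1 ≤ ‖ξ‖ →
      (1 + ‖ξ‖) ^ N * ‖∫ s, (1 - ((b (w + (‖ξ‖ ^ (1 - α))⁻¹ • s) : ℝ) : ℂ)) *
        (f s * freq u Θ (ξ + (2 * Real.pi * ‖ξ‖ ^ (1 - α)) • w + (2 * Real.pi) • s))‖ ≤ C := by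
  obtain ⟨C₀, K, hC₀, hgrow⟩ := exists_freq_bound u Θ
  obtain ⟨L, hL⟩ := exists_one_add_pow_le (sub_pos.2 hα1) (N + K)
  have hrI : 0 < b.rIn := b.rIn_pos
  set c₁ := 1 + 2 * Real.pi * ‖w‖
  set c₂ := 1 + |2 * Real.pi|
  have hc₁ : 0 ≤ c₁ := by positivity
  have hc₂ : 0 ≤ c₂ := by positivity
  set D := 2 ^ (N + K) * (1 / b.rIn) ^ L * (C₀ * (c₁ * c₂) ^ K)
  refine ⟨∫ s, D * ((1 + ‖s‖) ^ (L + K) * ‖f s‖), integral_nonneg fun s => by positivity,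
    fun ξ hξ => ?_⟩
  have hξ0 : 0 < ‖ξ‖ := by linarith
  have hc : 0 < ‖ξ‖ ^ (1 - α) := by positivity
  refine mul_norm_integral_le (by positivity)
    ((integrable_one_add_norm_pow_mul f _).const_mul D) fun s => ?_
  rw [norm_mul, norm_mul]
  rcases le_or_gt ‖(‖ξ‖ ^ (1 - α))⁻¹ • s‖ b.rIn with hle | hgt
  · have h1 : b (w + (‖ξ‖ ^ (1 - α))⁻¹ • s) = 1 :=
      b.one_of_mem_closedBall (by simpa [dist_eq_norm] using hle)
    rw [h1, Complex.ofReal_one, sub_self, norm_zero, zero_mul, mul_zero]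
    positivity
  · rw [norm_smul, norm_inv, Real.norm_of_nonneg hc.le, ← div_eq_inv_mul, lt_div_iff₀ hc] at hgt
    have hle : ‖ξ‖ ^ (1 - α) ≤ 1 / b.rIn * (1 + ‖s‖) := by
      rw [one_div_mul_eq_div, le_div_iff₀ hrI]
      linarith
    have hb1 : ‖1 - ((b (w + (‖ξ‖ ^ (1 - α))⁻¹ • s) : ℝ) : ℂ)‖ ≤ 1 := by
      rw [← Complex.ofReal_one, ← Complex.ofReal_sub, Complex.norm_real, Real.norm_eq_abs, abs_le]
      have h2 := b.nonneg (x := w + (‖ξ‖ ^ (1 - α))⁻¹ • s)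
      have h3 := b.le_one (x := w + (‖ξ‖ ^ (1 - α))⁻¹ • s)
      constructor <;> linarith
    have hfreq : ‖freq u Θ (ξ + (2 * Real.pi * ‖ξ‖ ^ (1 - α)) • w + (2 * Real.pi) • s)‖ ≤
        C₀ * (c₁ * (1 + ‖ξ‖) * (c₂ * (1 + ‖s‖))) ^ K := by
      refine (hgrow _).trans ?_
      gcongr
      refine (one_add_norm_add_le _ _).trans ?_
      gcongr
      · exact one_add_norm_add_rpow_smul_le hα.le w hξ
      · exact one_add_norm_smul_le _ _
    calc (1 + ‖ξ‖) ^ N * (‖1 - ((b (w + (‖ξ‖ ^ (1 - α))⁻¹ • s) : ℝ) : ℂ)‖ * (‖f s‖ * ‖freq u Θ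
          (ξ + (2 * Real.pi * ‖ξ‖ ^ (1 - α)) • w + (2 * Real.pi) • s)‖))
        ≤ (1 + ‖ξ‖) ^ N * (1 * (‖f s‖ * (C₀ * (c₁ * (1 + ‖ξ‖) * (c₂ * (1 + ‖s‖))) ^ K))) := by
          gcongr
      _ = (1 + ‖ξ‖) ^ (N + K) * (C₀ * (c₁ * c₂) ^ K * (1 + ‖s‖) ^ K * ‖f s‖) := by
          rw [pow_add, mul_pow, mul_pow, mul_pow, mul_pow]; ring
      _ ≤ (2 ^ (N + K) * (1 / b.rIn * (1 + ‖s‖)) ^ L) *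
            (C₀ * (c₁ * c₂) ^ K * (1 + ‖s‖) ^ K * ‖f s‖) := by
          gcongr
          refine (hL _ hξ).trans ?_
          gcongr
      _ = _ := by
          rw [mul_pow _ (1 + ‖s‖), pow_add]; ring

theorem AveragesDecay.isMicrolocallyRegularAt_of_lt_one {α : ℝ} (hα : 0 < α) (hα1 : α < 1)
    {Θ ψ : 𝓢(Space d, ℂ)} (hψ0 : ψ ≠ 0) (hψ : HasCompactSupport ψ)
    {u : 𝓢(Space d, ℂ) →L[ℂ] ℂ} {x₀ ξ₀ : Space d}
    {U Γ : Set (Space d)} {R : ℝ} (hΘ0 : Θ x₀ ≠ 0) (hU : IsOpen U)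
    (hx₀ : x₀ ∈ U) (hΓ : IsOpenCone Γ) (hξ₀ : ξ₀ ∈ Γ)
    (h : AveragesDecay α ψ u Θ U Γ R) : IsMicrolocallyRegularAt u x₀ ξ₀ := by
  obtain ⟨w, hw⟩ : ∃ w, ψ w ≠ 0 := by
    by_contra! h0
    exact hψ0 (SchwartzMap.ext fun s => by simpa using h0 s)
  obtain ⟨θ, κ, hκ⟩ := exists_bump_div (ψ.smooth ⊤) hw
  obtain ⟨δ, hδ, hball⟩ := Metric.isOpen_iff.1 hU x₀ hx₀
  let b : ContDiffBump x₀ := ⟨δ / 4, δ / 2, by linarith, by linarith⟩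
  have hb : Metric.ball x₀ (2 * b.rOut) ⊆ U := by
    have : 2 * b.rOut = δ := by
      change 2 * (δ / 2) = δ
      ring
    rwa [this]
  obtain ⟨Γ', ε, hΓ', hξ₀', hε, hε2, hsub⟩ := hΓ.exists_smaller hξ₀
  obtain ⟨R', hR'⟩ := exists_preimage_in_cone hα w hε hε2 hsub
  refine ⟨bumpMul b Θ, Γ', max R' (2 * max R 1), hasCompactSupport_bumpMul b Θ, ?_, hΓ', hξ₀',
    fun N => ?_⟩
  · rw [bumpMul_apply, b.one_of_mem_closedBall (Metric.mem_closedBall_self b.rIn_pos.le)]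
    simpa using hΘ0
  -- The extra `d` powers pay for the Jacobian `l ^ d` of the rescaling in `hmain`.
  obtain ⟨C₁, hC₁, h1⟩ := h.exists_localized_bound hα hα1 hψ κ b hb w (N + d)
  obtain ⟨C₂, hC₂, h2⟩ := exists_tail_bound hα hα1 u Θ (𝓕⁻ (bumpSchwartz b)) θ N
  set c := 1 + 2 * Real.pi * ‖w‖
  have hc0 : 0 ≤ c := by positivity
  refine ⟨c ^ N * (C₁ + C₂), by positivity, fun ζ hζ hRζ => ?_⟩
  obtain ⟨ξ, hξ, hle, rfl⟩ := hR' ζ hζ ((le_max_left _ _).trans hRζ)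
  have hmax : max R 1 ≤ ‖ξ‖ := by
    have := (le_max_right _ _).trans hRζ
    linarith
  have hξ1 : 1 ≤ ‖ξ‖ := (le_max_right _ _).trans hmax
  have hξR : R ≤ ‖ξ‖ := (le_max_left _ _).trans hmax
  have hξ0 : 0 < ‖ξ‖ := by linarith
  set l := ‖ξ‖ ^ (1 - α)
  have hl : 0 < l := by positivity
  set f : 𝓢(Space d, ℂ) := 𝓕⁻ (bumpSchwartz b)
  set ζ := ξ + (2 * Real.pi * l) • w
  have hA : Continuous fun s : Space d => freq u Θ (ζ + (2 * Real.pi) • s) :=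
    (continuous_freq u Θ).comp (by fun_prop)
  have hfA : Integrable fun s => f s * freq u Θ (ζ + (2 * Real.pi) • s) := by
    obtain ⟨C₀, K, hC₀, hgrow⟩ := exists_freq_bound u Θ
    refine ((integrable_one_add_norm_pow_mul f K).const_mul
      (C₀ * ((1 + ‖ζ‖) * (1 + |2 * Real.pi|)) ^ K)).mono'
      (f.continuous.mul hA).aestronglyMeasurable (Filter.Eventually.of_forall fun s => ?_)
    rw [norm_mul]
    calc ‖f s‖ * ‖freq u Θ (ζ + (2 * Real.pi) • s)‖
        ≤ ‖f s‖ * (C₀ * ((1 + ‖ζ‖) * ((1 + |2 * Real.pi|) * (1 + ‖s‖))) ^ K) := by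
          gcongr
          refine (hgrow _).trans ?_
          gcongr
          exact (one_add_norm_add_le _ _).trans (by gcongr; exact one_add_norm_smul_le _ _)
      _ = _ := by rw [← mul_assoc (1 + ‖ζ‖), mul_pow _ (1 + ‖s‖)]; ring
  have hθc : Continuous fun s : Space d => ((θ (w + l⁻¹ • s) : ℝ) : ℂ) :=
    Complex.continuous_ofReal.comp (θ.continuous.comp (by fun_prop))
  have hθb : ∀ s : Space d, ‖((θ (w + l⁻¹ • s) : ℝ) : ℂ)‖ ≤ 1 := fun s => by
    rw [Complex.norm_real, Real.norm_of_nonneg θ.nonneg]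
    exact θ.le_one
  have hθA := hfA.bdd_mul hθc.aestronglyMeasurable (Filter.Eventually.of_forall hθb)
  have hsplit : freq u (bumpMul b Θ) ζ =
      (∫ s, ((θ (w + l⁻¹ • s) : ℝ) : ℂ) * (f s * freq u Θ (ζ + (2 * Real.pi) • s))) +
      ∫ s, (1 - ((θ (w + l⁻¹ • s) : ℝ) : ℂ)) * (f s * freq u Θ (ζ + (2 * Real.pi) • s)) := by
    rw [freq_eq_averagedFreq_of_fourierInv u Θ _ (bumpSchwartz b) (fun t => by
      rw [bumpMul_apply, bumpSchwartz_apply])]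
    simp_rw [sub_mul, one_mul]
    rw [integral_sub hfA hθA, add_sub_cancel]
    unfold averagedFreq
    refine integral_congr_ae (Filter.Eventually.of_forall fun s => ?_)
    simp [osc, f]
  -- Substitute `l • (s - w)` for `s`, and replace the bump `θ` by `κ * ψ`; this reveals the window
  -- average.
  have hmain : (∫ s, ((θ (w + l⁻¹ • s) : ℝ) : ℂ) * (f s * freq u Θ (ζ + (2 * Real.pi) • s))) =
      ((l ^ d : ℝ) : ℂ) * ∫ s, κ s * ψ s * freq u Θ (ξ + (2 * Real.pi * l) • s) *
        f (l • (s - w)) := by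
    have hcv := Measure.integral_comp_smul_of_nonneg (μ := (volume : Measure (Space d)))
      (fun s => ((θ (w + l⁻¹ • s) : ℝ) : ℂ) * (f s * freq u Θ (ζ + (2 * Real.pi) • s))) l
      (hR := hl.le)
    rw [finrank_euclideanSpace_fin] at hcv
    have hld : (l ^ d : ℝ) ≠ 0 := by positivity
    rw [← integral_sub_right_eq_self _ w] at hcv
    rw [eq_inv_smul_iff₀ hld] at hcv
    rw [← hcv, Complex.real_smul]
    congr 1
    refine integral_congr_ae (Filter.Eventually.of_forall fun s => ?_)
    simp only [hκ]
    rw [inv_smul_smul₀ hl.ne', add_sub_cancel]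
    have : ζ + (2 * Real.pi) • l • (s - w) = ξ + (2 * Real.pi * l) • s := by
      simp only [ζ]
      module
    rw [this]
    ring
  have hld : l ^ d ≤ (1 + ‖ξ‖) ^ d := by
    gcongr
    exact (rpow_one_sub_le_self hα.le hξ1).trans (by linarith)
  have e1 := h1 ξ hξ hξR hξ1
  have e2 := h2 ξ hξ1
  have e3 : 1 + ‖ζ‖ ≤ c * (1 + ‖ξ‖) := one_add_norm_add_rpow_smul_le hα.le w hξ1
  rw [hsplit, hmain]
  set I₁ := ∫ s, κ s * ψ s * freq u Θ (ξ + (2 * Real.pi * l) • s) * f (l • (s - w))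
  set I₂ := ∫ s, (1 - ((θ (w + l⁻¹ • s) : ℝ) : ℂ)) * (f s * freq u Θ (ζ + (2 * Real.pi) • s))
  calc (1 + ‖ζ‖) ^ N * ‖((l ^ d : ℝ) : ℂ) * I₁ + I₂‖
      ≤ (c * (1 + ‖ξ‖)) ^ N * ((1 + ‖ξ‖) ^ d * ‖I₁‖ + ‖I₂‖) := by
        gcongr
        refine (norm_add_le _ _).trans ?_
        rw [norm_mul, Complex.norm_real, Real.norm_of_nonneg (by positivity)]
        gcongr
    _ = c ^ N * ((1 + ‖ξ‖) ^ (N + d) * ‖I₁‖ + (1 + ‖ξ‖) ^ N * ‖I₂‖) := by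
        rw [mul_pow, pow_add]; ring
    _ ≤ c ^ N * (C₁ + C₂) := by gcongr

/-! ### Polynomials on Euclidean space -/

/-- The value at `s` of a polynomial in the coordinates. -/
def polyEval (P : MvPolynomial (Fin d) ℂ) (s : Space d) : ℂ :=
  MvPolynomial.eval (fun j => ((s j : ℝ) : ℂ)) P

theorem contDiff_polyEval (P : MvPolynomial (Fin d) ℂ) : ContDiff ℝ ∞ (polyEval P) := by
  unfold polyEval
  induction P using MvPolynomial.induction_on with
  | C a => simpa using contDiff_const (𝕜 := ℝ) (E := Space d) (c := a)
  | add p q hp hq => simpa using hp.add hq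
  | mul_X p j hp =>
    have : ContDiff ℝ ∞ fun s : Space d => ((s j : ℝ) : ℂ) :=
      Complex.ofRealCLM.contDiff.comp (EuclideanSpace.proj (𝕜 := ℝ) j).contDiff
    simpa using hp.mul this

theorem polyEval_mul (P Q : MvPolynomial (Fin d) ℂ) (s : Space d) :
    polyEval (P * Q) s = polyEval P s * polyEval Q s := by
  simp [polyEval]

theorem inner_eq_polyEval (y s : Space d) :
    ((inner ℝ s y : ℝ) : ℂ) =
      polyEval (∑ j, MvPolynomial.C ((y j : ℝ) : ℂ) * MvPolynomial.X j) s := by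
  simp [polyEval, PiLp.inner_apply]

/-- An open set contains a product of intervals, and a polynomial that vanishes on a product of
infinite sets is zero. -/
theorem eq_zero_of_polyEval_eq_zero {Q : MvPolynomial (Fin d) ℂ} {V : Set (Space d)}
    (hV : IsOpen V) (hne : V.Nonempty) (h : ∀ s ∈ V, polyEval Q s = 0) : Q = 0 := by
  obtain ⟨s₀, hs₀⟩ := hne
  have hV' : IsOpen ((WithLp.toLp 2 : (Fin d → ℝ) → Space d) ⁻¹' V) :=
    hV.preimage (PiLp.continuous_toLp 2 _)
  obtain ⟨ε, hε, hball⟩ := Metric.isOpen_iff.1 hV' (fun j => s₀ j) hs₀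
  refine MvPolynomial.funext_set
    (fun j => Complex.ofReal '' Set.Ioo (s₀ j) (s₀ j + ε)) (fun j =>
      (Set.Ioo_infinite (by linarith)).image Complex.ofReal_injective.injOn) fun x hx => ?_
  choose t ht htx using fun j => hx j (Set.mem_univ j)
  have hmem : t ∈ Metric.ball (fun j => s₀ j) ε := by
    rw [Metric.mem_ball, dist_pi_lt_iff hε]
    intro j
    rw [Real.dist_eq, abs_lt]
    constructor <;> linarith [(ht j).1, (ht j).2]
  have h0 := h _ (hball hmem)
  have hx' : x = fun j => ((t j : ℝ) : ℂ) := funext fun j => (htx j).symm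
  rw [hx', map_zero]
  exact h0

/-- Powers of `⟨s, w⟩` are polynomials in `s`, so all directional moments vanish and with them the
Fourier transform. -/
theorem eq_zero_of_integral_mul_polyEval_eq_zero {g : 𝓢(Space d, ℂ)} (hg : HasCompactSupport g)
    (h : ∀ P : MvPolynomial (Fin d) ℂ, ∫ s, g s * polyEval P s = 0) : g = 0 := by
  have hF : 𝓕 g = 0 := by
    ext w
    have h1 := fourier_smul_eq_integral g 1 w
    rw [one_smul, mul_one] at h1
    rw [h1]
    have h2 := integral_mul_osc_eq_zero_of_moments g.continuous hg ((2 * Real.pi) • w) fun k => by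
      have h3 := h ((MvPolynomial.C (-Complex.I) *
        ∑ j, MvPolynomial.C ((((2 * Real.pi) • w) j : ℝ) : ℂ) * MvPolynomial.X j) ^ k)
      rw [← h3]
      refine integral_congr_ae (Filter.Eventually.of_forall fun s => ?_)
      simp only [inner_eq_polyEval]
      simp [polyEval]
    refine Eq.trans ?_ h2
    refine integral_congr_ae (Filter.Eventually.of_forall fun s => ?_)
    simp only [osc, inner_smul_right, real_inner_comm s w]
  have := congrArg (fun f : 𝓢(Space d, ℂ) => 𝓕⁻ f) hF
  simpa using this

theorem integrable_mul_polyEval {ψ : 𝓢(Space d, ℂ)} (hψ : HasCompactSupport ψ)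
    (P Q : MvPolynomial (Fin d) ℂ) : Integrable fun s => ψ s * polyEval P s * polyEval Q s :=
  ((ψ.continuous.mul (contDiff_polyEval P).continuous).mul
    (contDiff_polyEval Q).continuous).integrable_of_hasCompactSupport hψ.mul_right.mul_right

/-- The bilinear pairing of polynomials with respect to a compactly supported weight. -/
def polyPairing (ψ : 𝓢(Space d, ℂ)) (hψ : HasCompactSupport ψ) :
    MvPolynomial (Fin d) ℂ →ₗ[ℂ] MvPolynomial (Fin d) ℂ →ₗ[ℂ] ℂ :=
  LinearMap.mk₂ ℂ (fun P Q => ∫ s, ψ s * polyEval P s * polyEval Q s)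
    (fun P P' Q => by
      rw [← integral_add (integrable_mul_polyEval hψ P Q) (integrable_mul_polyEval hψ P' Q)]
      refine integral_congr_ae (Filter.Eventually.of_forall fun s => ?_)
      simp only [polyEval, map_add]
      ring)
    (fun c P Q => by
      rw [smul_eq_mul, ← integral_const_mul]
      refine integral_congr_ae (Filter.Eventually.of_forall fun s => ?_)
      simp only [polyEval, MvPolynomial.smul_eval]
      ring)
    (fun P Q Q' => by
      rw [← integral_add (integrable_mul_polyEval hψ P Q) (integrable_mul_polyEval hψ P Q')]
      refine integral_congr_ae (Filter.Eventually.of_forall fun s => ?_)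
      simp only [polyEval, map_add]
      ring)
    (fun c P Q => by
      rw [smul_eq_mul, ← integral_const_mul]
      refine integral_congr_ae (Filter.Eventually.of_forall fun s => ?_)
      simp only [polyEval, MvPolynomial.smul_eval]
      ring)

theorem polyPairing_apply (ψ : 𝓢(Space d, ℂ)) (hψ : HasCompactSupport ψ)
    (P Q : MvPolynomial (Fin d) ℂ) :
    polyPairing ψ hψ P Q = ∫ s, ψ s * polyEval P s * polyEval Q s := rfl

/-- All moments of `ψ Q` vanish, hence `ψ Q = 0`, and `Q` vanishes on the nonempty open set where `ψ
≠ 0`. -/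
theorem eq_zero_of_polyPairing_eq_zero {ψ : 𝓢(Space d, ℂ)} (hψ0 : ψ ≠ 0)
    (hψ : HasCompactSupport ψ) {Q : MvPolynomial (Fin d) ℂ}
    (h : ∀ P, polyPairing ψ hψ P Q = 0) : Q = 0 := by
  have hc : HasCompactSupport fun s => ψ s * polyEval Q s := hψ.mul_right
  have hz : hc.toSchwartzMap ((ψ.smooth ⊤).mul (contDiff_polyEval Q)) = 0 := by
    refine eq_zero_of_integral_mul_polyEval_eq_zero hc fun P => ?_
    rw [← h P, polyPairing_apply]
    refine integral_congr_ae (Filter.Eventually.of_forall fun s => ?_)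
    change ψ s * polyEval Q s * polyEval P s = _
    ring
  refine eq_zero_of_polyEval_eq_zero (V := {s | ψ s ≠ 0})
    (isOpen_ne_fun ψ.continuous continuous_const) ?_ fun s hs => ?_
  · by_contra hne
    rw [Set.not_nonempty_iff_eq_empty] at hne
    refine hψ0 (SchwartzMap.ext fun s => ?_)
    by_contra hs
    exact (hne ▸ (show s ∈ {s | ψ s ≠ 0} from hs) : s ∈ (∅ : Set (Space d)))
  · have h1 : ψ s * polyEval Q s = 0 := DFunLike.congr_fun hz s
    exact (mul_eq_zero.1 h1).resolve_left hs

/-- In finite dimension, a subspace of the dual with trivial common kernel is the whole dual. -/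
theorem exists_apply_eq_of_separating {K V W : Type*} [Field K] [AddCommGroup V] [Module K V]
    [AddCommGroup W] [Module K W] [FiniteDimensional K W] (B : V →ₗ[K] W →ₗ[K] K)
    (hB : ∀ w, (∀ v, B v w = 0) → w = 0) (f : W →ₗ[K] K) : ∃ v, B v = f := by
  have hmem : f ∈ Submodule.span K (Set.range B) := by
    refine FiniteDimensional.mem_span_of_iInf_ker_le_ker fun w hw => ?_
    rw [hB w fun v => (Submodule.mem_iInf _).1 hw v]
    exact Submodule.zero_mem _
  rwa [← LinearMap.coe_range, Submodule.span_eq] at hmem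

/-- A compactly supported nonzero weight admits polynomials that reproduce the value at the origin
of all polynomials of bounded degree. -/
theorem exists_reproducing_polynomial {ψ : 𝓢(Space d, ℂ)} (hψ0 : ψ ≠ 0)
    (hψ : HasCompactSupport ψ) (M : ℕ) :
    ∃ P : MvPolynomial (Fin d) ℂ, ∀ Q : MvPolynomial (Fin d) ℂ, Q.totalDegree ≤ M →
      ∫ s, ψ s * polyEval P s * polyEval Q s = polyEval Q 0 := by
  obtain ⟨P, hP⟩ := exists_apply_eq_of_separating
    (W := MvPolynomial.restrictTotalDegree (Fin d) ℂ M)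
    ((polyPairing ψ hψ).domRestrict₂ (MvPolynomial.restrictTotalDegree (Fin d) ℂ M)) (fun Q hQ => Subtype.ext
      (eq_zero_of_polyPairing_eq_zero hψ0 hψ hQ))
    ((MvPolynomial.aeval (R := ℂ) fun _ : Fin d => (0 : ℂ)).toLinearMap.comp
      (MvPolynomial.restrictTotalDegree (Fin d) ℂ M).subtype)
  refine ⟨P, fun Q hQ => ?_⟩
  have h1 : polyPairing ψ hψ P Q = MvPolynomial.aeval (R := ℂ) (fun _ : Fin d => (0 : ℂ)) Q :=
    LinearMap.congr_fun hP ⟨Q, (MvPolynomial.mem_restrictTotalDegree _ _ _).2 hQ⟩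
  rw [← polyPairing_apply ψ hψ, h1]
  simp only [polyEval, MvPolynomial.aeval_def, MvPolynomial.eval, MvPolynomial.coe_eval₂Hom]
  congr 1

theorem mulInner_smul_eq_sum (c : ℝ) (s : Space d) (f : 𝓢(Space d, ℂ)) :
    mulInner (c • s) f =
      ∑ j, (((c * s j : ℝ)) : ℂ) • mulInner (EuclideanSpace.single j 1) f := by
  ext t
  have h : ∀ j, (inner ℝ t (EuclideanSpace.single j (1 : ℝ)) : ℝ) = t j := fun j => by
    simp [EuclideanSpace.inner_single_right]
  simp only [sum_apply, smul_apply, mulInner_apply, smul_eq_mul, inner_smul_right, h]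
  simp only [PiLp.inner_apply, RCLike.inner_apply, conj_trivial]
  push_cast
  simp only [Finset.mul_sum, Finset.sum_mul, ← Finset.sum_neg_distrib]
  refine Finset.sum_congr rfl fun j _ => ?_
  ring

theorem freq_mulInner_iterate_sum (u : 𝓢(Space d, ℂ) →L[ℂ] ℂ) (y ξ : Space d) (k : ℕ)
    (a : Fin d → ℂ) (f : Fin d → 𝓢(Space d, ℂ)) :
    freq u ((mulInner y)^[k] (∑ j, a j • f j)) ξ =
      ∑ j, a j * freq u ((mulInner y)^[k] (f j)) ξ := by
  rw [show (mulInner y)^[k] = ⇑((mulInner y) ^ k) from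
    (FunLike.coe_pow_eq_iterate _ _).symm]
  simp [freq]

/-- Each `mulInner (c • s)` is linear in the coordinates of `s`; peeling off one factor raises the
degree by at most one. -/
theorem exists_polyEval_eq_freq (u : 𝓢(Space d, ℂ) →L[ℂ] ℂ) (c : ℝ) (ξ : Space d) (k : ℕ)
    (Θ : 𝓢(Space d, ℂ)) :
    ∃ Q : MvPolynomial (Fin d) ℂ, Q.totalDegree ≤ k ∧
      ∀ s, polyEval Q s = freq u ((mulInner (c • s))^[k] Θ) ξ := by
  induction k generalizing Θ with
  | zero =>
    exact ⟨MvPolynomial.C (freq u Θ ξ), by simp, fun s => by simp [polyEval]⟩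
  | succ k ih =>
    choose Q hQ hQs using fun j => ih (mulInner (EuclideanSpace.single j 1) Θ)
    refine ⟨∑ j, (MvPolynomial.C (c : ℂ) * MvPolynomial.X j) * Q j, ?_, fun s => ?_⟩
    · refine MvPolynomial.totalDegree_finsetSum_le fun j _ => ?_
      refine (MvPolynomial.totalDegree_mul _ _).trans ?_
      rw [add_comm k]
      refine add_le_add ((MvPolynomial.totalDegree_mul _ _).trans ?_) (hQ j)
      simp
    · rw [Function.iterate_succ_apply, mulInner_smul_eq_sum, freq_mulInner_iterate_sum]
      simp only [← hQs]
      simp [polyEval]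

/-- Taylor polynomials of `freq`. -/
theorem exists_polyEval_eq_taylor (u : 𝓢(Space d, ℂ) →L[ℂ] ℂ) (c : ℝ) (ξ : Space d) (M : ℕ)
    (Θ : 𝓢(Space d, ℂ)) :
    ∃ Q : MvPolynomial (Fin d) ℂ, Q.totalDegree ≤ M ∧
      ∀ s, polyEval Q s = ∑ k ∈ Finset.range M,
        ((k.factorial : ℂ)⁻¹) * freq u ((mulInner (c • s))^[k] Θ) ξ := by
  choose Q hQ hQs using fun k => exists_polyEval_eq_freq u c ξ k Θ
  refine ⟨∑ k ∈ Finset.range M, ((k.factorial : ℂ)⁻¹) • Q k, ?_, fun s => ?_⟩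
  · refine MvPolynomial.totalDegree_finsetSum_le fun k hk => ?_
    exact (MvPolynomial.totalDegree_smul_le _ _).trans
      ((hQ k).trans (Finset.mem_range.1 hk).le)
  · simp only [← hQs]
    simp [polyEval, MvPolynomial.smul_eval]

/-! ### Integrals against the Fourier transform of a test function -/

/-- The Fourier transform of `g` is an instance of `freq`, for the integration functional, so the
same growth and Taylor bounds apply to it. -/
theorem freq_integralCLM (g : 𝓢(Space d, ℂ)) (η : Space d) :
    freq (SchwartzMap.integralCLM ℂ volume) g η = ∫ t, osc η t * g t := by
  unfold freq
  rw [SchwartzMap.integralCLM_apply]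
  refine integral_congr_ae (Filter.Eventually.of_forall fun t => ?_)
  simp only [SchwartzMap.smulLeftCLM_apply_apply (hasTemperateGrowth_osc η), smul_eq_mul]

open LineDeriv in
theorem freq_integralCLM_lineDeriv (g : 𝓢(Space d, ℂ)) (m η : Space d) :
    freq (SchwartzMap.integralCLM ℂ volume) (∂_{m} g) η =
      Complex.I * (inner ℝ η m : ℝ) * freq (SchwartzMap.integralCLM ℂ volume) g η := by
  have h : ∀ f : 𝓢(Space d, ℂ), freq (SchwartzMap.integralCLM ℂ volume) f η =
      (𝓕 f) ((2 * Real.pi)⁻¹ • η) := fun f => by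
    rw [freq_integralCLM]
    exact (fourierHat_eq_integral f η).symm
  rw [h, h, SchwartzMap.fourier_lineDerivOp_eq]
  have ht : (inner ℝ · m : Space d → ℝ).HasTemperateGrowth :=
    Function.hasTemperateGrowth_inner_left m
  simp only [smul_apply, SchwartzMap.smulLeftCLM_apply_apply ht, inner_smul_left, smul_eq_mul,
    Complex.real_smul, conj_trivial]
  push_cast
  have hpi : (Real.pi : ℂ) ≠ 0 := by exact_mod_cast Real.pi_ne_zero
  field_simp

/-- The localized Fourier transform of `u` integrated against a polynomial weight and the Fourier
transform of a test function. -/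
def weightedFreq (u : 𝓢(Space d, ℂ) →L[ℂ] ℂ) (Θ ψ g : 𝓢(Space d, ℂ))
    (P : MvPolynomial (Fin d) ℂ) (μ : ℝ) (ξ : Space d) : ℂ :=
  ∫ s, ψ s * polyEval P s * (freq u Θ (ξ + μ • s) *
    freq (SchwartzMap.integralCLM ℂ volume) g (-(μ • s)))

theorem integrable_weightedFreq (u : 𝓢(Space d, ℂ) →L[ℂ] ℂ) (Θ : 𝓢(Space d, ℂ))
    {ψ : 𝓢(Space d, ℂ)} (hψ : HasCompactSupport ψ) (g : 𝓢(Space d, ℂ))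
    (P : MvPolynomial (Fin d) ℂ) (μ : ℝ) (ξ : Space d) :
    Integrable fun s => ψ s * polyEval P s * (freq u Θ (ξ + μ • s) *
      freq (SchwartzMap.integralCLM ℂ volume) g (-(μ • s))) :=
  ((ψ.continuous.mul (contDiff_polyEval P).continuous).mul
    (((continuous_freq u Θ).comp (by fun_prop)).mul
      ((continuous_freq _ g).comp (by fun_prop)))).integrable_of_hasCompactSupport
    hψ.mul_right.mul_right

/-- Fubini: without weight, one obtains the average over positions against `g`, to which the decay
hypothesis applies on the support of `g`. -/
theorem weightedFreq_one (u : 𝓢(Space d, ℂ) →L[ℂ] ℂ) (Θ : 𝓢(Space d, ℂ)) {ψ : 𝓢(Space d, ℂ)}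
    (hψ : HasCompactSupport ψ) (g : 𝓢(Space d, ℂ)) (μ : ℝ) (ξ : Space d) :
    weightedFreq u Θ ψ g 1 μ ξ = ∫ x, g x * averagedFreq u Θ ψ μ x ξ := by
  have hprod : Integrable (Function.uncurry fun s x : Space d =>
      osc (μ • s) (-x) * ((ψ s * freq u Θ (ξ + μ • s)) * g x)) (volume.prod volume) := by
    have h1 := (integrable_mul_freq u Θ ψ.continuous hψ μ ξ).mul_prod (g.integrable (μ := volume))
    refine h1.bdd_mul (f := fun p : Space d × Space d => osc (μ • p.1) (-p.2)) (c := 1) ?_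
      (Filter.Eventually.of_forall fun p => (norm_osc _ _).le)
    refine Continuous.aestronglyMeasurable ?_
    unfold osc
    fun_prop
  have h2 := integral_integral_swap hprod
  unfold weightedFreq averagedFreq
  refine Eq.trans (integral_congr_ae (Filter.Eventually.of_forall fun s => ?_))
    (h2.trans (integral_congr_ae (Filter.Eventually.of_forall fun x => ?_)))
  · simp only [freq_integralCLM, polyEval, map_one, mul_one]
    rw [← mul_assoc, ← integral_const_mul]
    refine integral_congr_ae (Filter.Eventually.of_forall fun x => ?_)
    simp only [osc, inner_neg_left, inner_neg_right]
    ring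
  · simp only []
    rw [← integral_const_mul]
    refine integral_congr_ae (Filter.Eventually.of_forall fun s => ?_)
    simp only []
    ring

open LineDeriv in
-- Integration by parts in position, read on the Fourier side: a coordinate weight is traded for a
-- derivative of `g` at the cost of one factor `μ⁻¹`.
theorem weightedFreq_mul_X (u : 𝓢(Space d, ℂ) →L[ℂ] ℂ) (Θ ψ g : 𝓢(Space d, ℂ))
    (P : MvPolynomial (Fin d) ℂ) (j : Fin d) {μ : ℝ} (hμ : μ ≠ 0) (ξ : Space d) :
    weightedFreq u Θ ψ g (P * MvPolynomial.X j) μ ξ =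
      (Complex.I * (μ⁻¹ : ℝ)) *
        weightedFreq u Θ ψ (∂_{(EuclideanSpace.single j (1 : ℝ) : Space d)} g) P μ ξ := by
  unfold weightedFreq
  rw [← integral_const_mul]
  refine integral_congr_ae (Filter.Eventually.of_forall fun s => ?_)
  have h : (inner ℝ (-(μ • s)) (EuclideanSpace.single j (1 : ℝ)) : ℝ) = -(μ * s j) := by
    simp [EuclideanSpace.inner_single_right]
  simp only [freq_integralCLM_lineDeriv, h, polyEval_mul]
  have hX : polyEval (MvPolynomial.X j) s = ((s j : ℝ) : ℂ) := by simp [polyEval]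
  rw [hX]
  have hμ' : (μ : ℂ) ≠ 0 := by exact_mod_cast hμ
  push_cast
  field_simp
  rw [Complex.I_sq]
  ring

open LineDeriv in
-- Induction on `P`: derivatives of `g` keep their support in `U`, and each `μ⁻¹` costs only a power
-- of `1 + ‖ξ‖`.
theorem AveragesDecay.exists_weightedFreq_bound {α : ℝ} {Θ ψ : 𝓢(Space d, ℂ)}
    (hψ : HasCompactSupport ψ) {u : 𝓢(Space d, ℂ) →L[ℂ] ℂ} {U Γ : Set (Space d)} {R : ℝ}
    (hR : 0 < R) (h : AveragesDecay α ψ u Θ U Γ R) (P : MvPolynomial (Fin d) ℂ)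
    (g : 𝓢(Space d, ℂ)) (hg : tsupport g ⊆ U) (N : ℕ) :
    ∃ C : ℝ, 0 ≤ C ∧ ∀ ξ ∈ Γ, R ≤ ‖ξ‖ →
      (1 + ‖ξ‖) ^ N * ‖weightedFreq u Θ ψ g P (2 * Real.pi * ‖ξ‖ ^ (1 - α)) ξ‖ ≤ C := by
  induction P using MvPolynomial.induction_on generalizing g N with
  | C a =>
    obtain ⟨C, hC, hb⟩ := h N
    refine ⟨‖a‖ * ∫ x, C * ‖g x‖, mul_nonneg (norm_nonneg _)
      (integral_nonneg fun x => by positivity), fun ξ hξ hRξ => ?_⟩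
    have h1 : weightedFreq u Θ ψ g (MvPolynomial.C a) (2 * Real.pi * ‖ξ‖ ^ (1 - α)) ξ =
        a * weightedFreq u Θ ψ g 1 (2 * Real.pi * ‖ξ‖ ^ (1 - α)) ξ := by
      unfold weightedFreq
      rw [← integral_const_mul]
      refine integral_congr_ae (Filter.Eventually.of_forall fun s => ?_)
      simp only [polyEval, MvPolynomial.eval_C, map_one]
      ring
    rw [h1, norm_mul, mul_left_comm, weightedFreq_one u Θ hψ]
    gcongr
    refine mul_norm_integral_le (by positivity) (g.integrable.norm.const_mul C) fun x => ?_
    by_cases hx : g x = 0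
    · simp [hx]
    · rw [norm_mul, mul_left_comm, mul_comm C]
      gcongr
      exact hb x (hg (subset_tsupport _ hx)) ξ hξ hRξ
  | add p q hp hq =>
    obtain ⟨C₁, hC₁, h1⟩ := hp g hg N
    obtain ⟨C₂, hC₂, h2⟩ := hq g hg N
    refine ⟨C₁ + C₂, by positivity, fun ξ hξ hRξ => ?_⟩
    have h3 : weightedFreq u Θ ψ g (p + q) (2 * Real.pi * ‖ξ‖ ^ (1 - α)) ξ =
        weightedFreq u Θ ψ g p (2 * Real.pi * ‖ξ‖ ^ (1 - α)) ξ +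
          weightedFreq u Θ ψ g q (2 * Real.pi * ‖ξ‖ ^ (1 - α)) ξ := by
      unfold weightedFreq
      rw [← integral_add (integrable_weightedFreq u Θ hψ g p _ ξ)
        (integrable_weightedFreq u Θ hψ g q _ ξ)]
      refine integral_congr_ae (Filter.Eventually.of_forall fun s => ?_)
      simp only [polyEval, map_add]
      ring
    rw [h3]
    calc _ ≤ (1 + ‖ξ‖) ^ N * (_ + _) := by gcongr; exact norm_add_le _ _
      _ ≤ _ := by rw [mul_add]; exact add_le_add (h1 ξ hξ hRξ) (h2 ξ hξ hRξ)
  | mul_X p j hp =>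
    obtain ⟨C₁, K, hC₁, h1⟩ := exists_rpow_le_one_add_pow hR (α - 1)
    obtain ⟨C₂, hC₂, h2⟩ := hp (∂_{(EuclideanSpace.single j (1 : ℝ) : Space d)} g)
      ((SchwartzMap.tsupport_lineDerivOp_subset _ g).trans hg) (N + K)
    refine ⟨C₁ * C₂, by positivity, fun ξ hξ hRξ => ?_⟩
    have hξ0 : 0 < ‖ξ‖ := hR.trans_le hRξ
    have hμ : 0 < 2 * Real.pi * ‖ξ‖ ^ (1 - α) := by positivity
    have hinv : (2 * Real.pi * ‖ξ‖ ^ (1 - α))⁻¹ ≤ C₁ * (1 + ‖ξ‖) ^ K := by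
      refine le_trans ?_ (h1 ‖ξ‖ hRξ)
      rw [mul_inv, ← Real.rpow_neg hξ0.le, neg_sub]
      refine mul_le_of_le_one_left (by positivity) (inv_le_one_of_one_le₀ ?_)
      linarith [Real.pi_gt_three]
    rw [weightedFreq_mul_X u Θ ψ g p j hμ.ne', norm_mul, norm_mul, Complex.norm_I, one_mul,
      Complex.norm_real, Real.norm_of_nonneg (by positivity)]
    have e2 := h2 ξ hξ hRξ
    set w := ‖weightedFreq u Θ ψ (∂_{(EuclideanSpace.single j (1 : ℝ) : Space d)} g) p
      (2 * Real.pi * ‖ξ‖ ^ (1 - α)) ξ‖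
    calc (1 + ‖ξ‖) ^ N * ((2 * Real.pi * ‖ξ‖ ^ (1 - α))⁻¹ * w)
        ≤ (1 + ‖ξ‖) ^ N * ((C₁ * (1 + ‖ξ‖) ^ K) * w) := by gcongr
      _ = C₁ * ((1 + ‖ξ‖) ^ (N + K) * w) := by rw [pow_add]; ring
      _ ≤ C₁ * C₂ := by gcongr

/-! ### The case of spreading packets -/

/-- The error of the product of two Taylor polynomials, in terms of the individual errors. -/
theorem norm_mul_sub_mul_le {F G A B : ℂ} {f g a b : ℝ} (hF : ‖F‖ ≤ f) (hG : ‖G‖ ≤ g)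
    (hA : ‖F - A‖ ≤ a) (hB : ‖G - B‖ ≤ b) : ‖F * G - A * B‖ ≤ f * b + a * (g + b) := by
  have h0 := norm_nonneg (F - A)
  have hB' : ‖B‖ ≤ g + b := by
    calc ‖B‖ = ‖G - (G - B)‖ := by congr 1; ring
      _ ≤ ‖G‖ + ‖G - B‖ := norm_sub_le _ _
      _ ≤ g + b := add_le_add hG hB
  calc ‖F * G - A * B‖ = ‖F * (G - B) + (F - A) * B‖ := by congr 1; ring
    _ ≤ ‖F‖ * ‖G - B‖ + ‖F - A‖ * ‖B‖ := by
        refine (norm_add_le _ _).trans ?_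
        rw [norm_mul, norm_mul]
    _ ≤ _ := by
        have hf := (norm_nonneg F).trans hF
        have ha := h0.trans hA
        gcongr

/-- Replace both Fourier transforms by their Taylor polynomials in `s`; the reproducing weight
evaluates the product at `s = 0`, and the error carries `μ ^ M`. The exponent `K` does not depend on
`M`. -/
theorem exists_weightedFreq_sub_bound {Θ ψ : 𝓢(Space d, ℂ)} (hψ0 : ψ ≠ 0)
    (hψ : HasCompactSupport ψ) (u : 𝓢(Space d, ℂ) →L[ℂ] ℂ) (g : 𝓢(Space d, ℂ)) (ρ : ℝ) :
    ∃ K : ℕ, ∀ M : ℕ, M ≠ 0 → ∃ (P : MvPolynomial (Fin d) ℂ) (C : ℝ), 0 ≤ C ∧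
      ∀ (μ : ℝ) (ξ : Space d), 0 ≤ μ → μ ≤ ρ →
        ‖weightedFreq u Θ ψ g P μ ξ - freq u Θ ξ * ∫ x, g x‖ ≤ C * (1 + ‖ξ‖) ^ K * μ ^ M := by
  set T := SchwartzMap.integralCLM (D := Space d) (V := ℂ) ℂ volume
  obtain ⟨C₀, K₀, hC₀, h0⟩ := exists_freq_bound u Θ
  obtain ⟨C₁, K₁, hC₁, h1⟩ := exists_freq_bound T g
  obtain ⟨K₂, hK₂⟩ := exists_freq_taylor_bound u
  obtain ⟨K₃, hK₃⟩ := exists_freq_taylor_bound T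
  refine ⟨K₀ + K₂, fun M hM => ?_⟩
  obtain ⟨C₂, hC₂, h2⟩ := hK₂ Θ M
  obtain ⟨C₃, hC₃, h3⟩ := hK₃ g M
  -- The degree `M + M` accommodates the product of two Taylor polynomials.
  obtain ⟨P, hP⟩ := exists_reproducing_polynomial hψ0 hψ (M + M)
  set σ := 1 + |ρ|
  set D : Space d → ℝ := fun s => C₀ * (σ * (1 + ‖s‖)) ^ K₀ *
      (C₃ * (‖s‖ ^ M * (σ * (1 + ‖s‖)) ^ K₃)) +
    C₂ * (‖s‖ ^ M * (σ * (1 + ‖s‖)) ^ K₂) *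
      (C₁ * (σ * (1 + ‖s‖)) ^ K₁ + C₃ * (‖s‖ ^ M * (σ * (1 + ‖s‖)) ^ K₃) * |ρ| ^ M)
  have hDc : Continuous D := by fun_prop
  have hDi : Integrable fun s => ‖ψ s * polyEval P s‖ * D s :=
    ((ψ.continuous.mul (contDiff_polyEval P).continuous).norm.mul
      hDc).integrable_of_hasCompactSupport hψ.mul_right.norm.mul_right
  have hD0 : ∀ s, 0 ≤ D s := fun s => by positivity
  refine ⟨P, ∫ s, ‖ψ s * polyEval P s‖ * D s,
    integral_nonneg fun s => mul_nonneg (norm_nonneg _) (hD0 s), fun μ ξ hμ hμρ => ?_⟩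
  obtain ⟨Q₁, hQ₁, e1⟩ := exists_polyEval_eq_taylor u μ ξ M Θ
  obtain ⟨Q₂, hQ₂, e2⟩ := exists_polyEval_eq_taylor T (-μ) 0 M g
  have hρ : μ ≤ |ρ| := hμρ.trans (le_abs_self ρ)
  have hσ : ∀ s : Space d, 1 + ‖μ • s‖ ≤ σ * (1 + ‖s‖) := fun s => by
    refine (one_add_norm_smul_le _ _).trans ?_
    rw [abs_of_nonneg hμ]
    have : 1 + μ ≤ σ := by simpa [σ] using hρ
    gcongr
  -- At zero displacement the Taylor bounds vanish because `M ≠ 0`, so both polynomials are exact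
  -- there.
  have hQ0 : polyEval (Q₁ * Q₂) 0 = freq u Θ ξ * ∫ x, g x := by
    have a1 := h2 ξ (μ • (0 : Space d))
    have a2 := h3 0 ((-μ) • (0 : Space d))
    rw [← e1] at a1
    rw [← e2] at a2
    simp only [smul_zero, norm_zero, zero_pow hM, zero_mul, mul_zero, add_zero] at a1 a2
    rw [polyEval_mul, ← sub_eq_zero.1 (norm_le_zero_iff.1 a1),
      ← sub_eq_zero.1 (norm_le_zero_iff.1 a2), freq_integralCLM]
    simp [osc]
  have hrep := hP (Q₁ * Q₂) ((MvPolynomial.totalDegree_mul _ _).trans (add_le_add hQ₁ hQ₂))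
  rw [← hQ0, ← hrep]
  unfold weightedFreq
  rw [← integral_sub (integrable_weightedFreq u Θ hψ g P μ ξ) (integrable_mul_polyEval hψ _ _),
    mul_assoc, ← integral_mul_const]
  refine norm_integral_le_of_norm_le (hDi.mul_const _) (Filter.Eventually.of_forall fun s => ?_)
  rw [polyEval_mul, ← mul_sub, norm_mul, mul_assoc]
  refine mul_le_mul_of_nonneg_left ?_ (norm_nonneg _)
  have b0 : ‖freq u Θ (ξ + μ • s)‖ ≤ C₀ * ((1 + ‖ξ‖) * (σ * (1 + ‖s‖))) ^ K₀ := by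
    refine (h0 _).trans ?_
    gcongr
    refine (one_add_norm_add_le _ _).trans ?_
    gcongr
    exact hσ s
  have b1 : ‖freq T g (-(μ • s))‖ ≤ C₁ * (σ * (1 + ‖s‖)) ^ K₁ := by
    refine (h1 _).trans ?_
    rw [norm_neg]
    gcongr
    exact hσ s
  have b2 : ‖freq u Θ (ξ + μ • s) - polyEval Q₁ s‖ ≤
      C₂ * (1 + ‖ξ‖) ^ K₂ * ((μ * ‖s‖) ^ M * (σ * (1 + ‖s‖)) ^ K₂) := by
    rw [e1]
    refine (h2 ξ (μ • s)).trans ?_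
    gcongr
    · rw [norm_smul, Real.norm_of_nonneg hμ]
    · exact hσ s
  have b3 : ‖freq T g (-(μ • s)) - polyEval Q₂ s‖ ≤
      C₃ * ((μ * ‖s‖) ^ M * (σ * (1 + ‖s‖)) ^ K₃) := by
    rw [e2]
    have := h3 0 ((-μ) • s)
    rw [zero_add, norm_zero, add_zero, one_pow, mul_one] at this
    rw [neg_smul] at this ⊢
    refine this.trans ?_
    rw [norm_neg]
    gcongr
    · rw [norm_smul, Real.norm_of_nonneg hμ]
    · exact hσ s
  refine (norm_mul_sub_mul_le b0 b1 b2 b3).trans ?_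
  have hx : 1 ≤ (1 + ‖ξ‖) ^ K₀ := one_le_pow₀ (by linarith [norm_nonneg ξ])
  have hx' : 1 ≤ (1 + ‖ξ‖) ^ K₂ := one_le_pow₀ (by linarith [norm_nonneg ξ])
  set S := σ * (1 + ‖s‖)
  have hS : 0 ≤ S := by positivity
  calc C₀ * ((1 + ‖ξ‖) * S) ^ K₀ * (C₃ * ((μ * ‖s‖) ^ M * S ^ K₃)) +
        C₂ * (1 + ‖ξ‖) ^ K₂ * ((μ * ‖s‖) ^ M * S ^ K₂) *
          (C₁ * S ^ K₁ + C₃ * ((μ * ‖s‖) ^ M * S ^ K₃))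
      = (C₀ * S ^ K₀ * (C₃ * (‖s‖ ^ M * S ^ K₃)) * ((1 + ‖ξ‖) ^ K₀ * 1) +
        C₂ * (‖s‖ ^ M * S ^ K₂) *
          (C₁ * S ^ K₁ + C₃ * (‖s‖ ^ M * S ^ K₃) * μ ^ M) * (1 * (1 + ‖ξ‖) ^ K₂)) * μ ^ M := by
        rw [mul_pow, mul_pow]; ring
    _ ≤ (C₀ * S ^ K₀ * (C₃ * (‖s‖ ^ M * S ^ K₃)) * ((1 + ‖ξ‖) ^ K₀ * (1 + ‖ξ‖) ^ K₂) +
        C₂ * (‖s‖ ^ M * S ^ K₂) *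
          (C₁ * S ^ K₁ + C₃ * (‖s‖ ^ M * S ^ K₃) * |ρ| ^ M) *
            ((1 + ‖ξ‖) ^ K₀ * (1 + ‖ξ‖) ^ K₂)) * μ ^ M := by
        gcongr
    _ = D s * ((1 + ‖ξ‖) ^ (K₀ + K₂) * μ ^ M) := by
        simp only [D]
        rw [pow_add]; ring

theorem AveragesDecay.isMicrolocallyRegularAt_of_one_lt {α : ℝ} (hα : 1 < α)
    {Θ ψ : 𝓢(Space d, ℂ)} (hψ0 : ψ ≠ 0) (hψ : HasCompactSupport ψ)
    {u : 𝓢(Space d, ℂ) →L[ℂ] ℂ} {x₀ ξ₀ : Space d} {U Γ : Set (Space d)} {R : ℝ}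
    (hΘ : HasCompactSupport Θ) (hΘ0 : Θ x₀ ≠ 0) (hU : IsOpen U) (hx₀ : x₀ ∈ U)
    (hΓ : IsOpenCone Γ) (hξ₀ : ξ₀ ∈ Γ) (h : AveragesDecay α ψ u Θ U Γ R) :
    IsMicrolocallyRegularAt u x₀ ξ₀ := by
  refine ⟨Θ, Γ, max R 1, hΘ, hΘ0, hΓ, hξ₀, fun N => ?_⟩
  obtain ⟨δ, hδ, hball⟩ := Metric.isOpen_iff.1 hU x₀ hx₀
  let b : ContDiffBump x₀ := ⟨δ / 4, δ / 2, by linarith, by linarith⟩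
  set g := bumpSchwartz b
  have hg : tsupport g ⊆ U := by
    refine (tsupport_comp_subset (g := Complex.ofReal) Complex.ofReal_zero b).trans ?_
    rw [b.tsupport_eq]
    exact (Metric.closedBall_subset_ball (by change δ / 2 < δ; linarith)).trans hball
  have hgi : ∫ x, g x ≠ 0 := by
    have h1 : ∫ x, g x = ((∫ x, b x : ℝ) : ℂ) := integral_ofReal
    rw [h1, Complex.ofReal_ne_zero]
    exact b.integral_pos.ne'
  obtain ⟨K, hK⟩ := exists_weightedFreq_sub_bound (Θ := Θ) hψ0 hψ u g (2 * Real.pi)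
  obtain ⟨L, hL⟩ := exists_one_add_pow_le (sub_pos.2 hα) (N + K)
  -- `L` powers of `μ` cancel `(1 + ‖ξ‖) ^ (N + K)`; the extra one makes the order nonzero and
  -- contributes a factor `t⁻¹ ≤ 1`.
  obtain ⟨P, C₁, hC₁, h1⟩ := hK (L + 1) L.succ_ne_zero
  obtain ⟨C₂, hC₂, h2⟩ := (h.mono (le_max_left R 1)).exists_weightedFreq_bound hψ
    (by positivity) P g hg N
  refine ⟨(C₂ + C₁ * (2 ^ (N + K) * (2 * Real.pi) ^ (L + 1))) / ‖∫ x, g x‖, by positivity,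
    fun ξ hξ hRξ => ?_⟩
  have hξ1 : 1 ≤ ‖ξ‖ := (le_max_right _ _).trans hRξ
  have hξ0 : 0 < ‖ξ‖ := by linarith
  set t := ‖ξ‖ ^ (α - 1)
  have ht1 : 1 ≤ t := Real.one_le_rpow hξ1 (by linarith)
  have ht0 : 0 < t := by linarith
  have hμt : ‖ξ‖ ^ (1 - α) = t⁻¹ := by
    rw [← Real.rpow_neg hξ0.le, neg_sub]
  have e2 := h2 ξ hξ hRξ
  rw [hμt] at e2
  set μ := 2 * Real.pi * t⁻¹
  have e1 := h1 μ ξ (by positivity)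
    (mul_le_of_le_one_right (by positivity) (inv_le_one_of_one_le₀ ht1))
  rw [le_div_iff₀ (norm_pos_iff.2 hgi), mul_assoc, ← norm_mul]
  have e3 : (1 + ‖ξ‖) ^ (N + K) * μ ^ (L + 1) ≤ 2 ^ (N + K) * (2 * Real.pi) ^ (L + 1) := by
    calc (1 + ‖ξ‖) ^ (N + K) * μ ^ (L + 1)
        ≤ (2 ^ (N + K) * t ^ L) * μ ^ (L + 1) := by gcongr; exact hL _ hξ1
      _ = 2 ^ (N + K) * (2 * Real.pi) ^ (L + 1) * t⁻¹ := by
          simp only [μ]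
          rw [mul_pow, inv_pow, pow_succ t]
          field_simp
      _ ≤ _ := mul_le_of_le_one_right (by positivity) (inv_le_one_of_one_le₀ ht1)
  calc (1 + ‖ξ‖) ^ N * ‖freq u Θ ξ * ∫ x, g x‖
      ≤ (1 + ‖ξ‖) ^ N * (‖weightedFreq u Θ ψ g P μ ξ‖ +
          ‖weightedFreq u Θ ψ g P μ ξ - freq u Θ ξ * ∫ x, g x‖) := by
        gcongr
        exact norm_le_norm_add_norm_sub _ _
    _ ≤ (1 + ‖ξ‖) ^ N * (‖weightedFreq u Θ ψ g P μ ξ‖ +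
          C₁ * (1 + ‖ξ‖) ^ K * μ ^ (L + 1)) := by gcongr
    _ = (1 + ‖ξ‖) ^ N * ‖weightedFreq u Θ ψ g P μ ξ‖ +
          C₁ * ((1 + ‖ξ‖) ^ (N + K) * μ ^ (L + 1)) := by rw [pow_add]; ring
    _ ≤ _ := by gcongr

/-! ### Equivalence with classical regularity, and the zero window -/

/-- For a nonzero admissible window, Gabor-microlocal regularity is classical microlocal
regularity. -/
theorem isGaborRegularAt_iff_isMicrolocallyRegularAt {α : ℝ} (hα : 0 < α) {φ : 𝓢(Space d, ℂ)}
    (hφ : IsAdmissibleWindow α φ) (hφ0 : φ ≠ 0) {u : 𝓢'(Space d, ℂ)} {x₀ ξ₀ : Space d} :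
    IsGaborRegularAt α φ u x₀ ξ₀ ↔ IsMicrolocallyRegularAt (distribCLM u) x₀ ξ₀ := by
  refine ⟨fun h => ?_, fun h => h.isGaborRegularAt hα hφ⟩
  obtain ⟨r, -, hr⟩ := hφ.exists_dualWindow_support
  have hψ : HasCompactSupport (dualWindow φ) := hasCompactSupport_of_norm_le hr
  have hψ0 : dualWindow φ ≠ 0 := dualWindow_eq_zero_iff.not.2 hφ0
  obtain ⟨Θ, U, Γ, R, hΘ, hΘ0, hU, hx₀, hΓ, hξ₀, -, hdecay⟩ := (isGaborRegularAt_iff hα).1 h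
  rcases lt_trichotomy α 1 with hα1 | rfl | hα1
  · exact hdecay.isMicrolocallyRegularAt_of_lt_one hα hα1 hψ0 hψ hΘ0 hU hx₀ hΓ hξ₀
  · exact hdecay.isMicrolocallyRegularAt_of_eq_one hφ0 hψ hΘ hΘ0 hU hx₀ hΓ hξ₀
  · exact hdecay.isMicrolocallyRegularAt_of_one_lt hα1 hψ0 hψ hΘ hΘ0 hU hx₀ hΓ hξ₀

/-- The zero window is admissible only if there are no nonzero Schwartz functions. -/
theorem IsAdmissibleWindow.eq_zero_of_zero {α : ℝ}
    (h : IsAdmissibleWindow α (0 : 𝓢(Space d, ℂ))) (f : 𝓢(Space d, ℂ)) : f = 0 := by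
  obtain ⟨xs, ξs, -, A, B, hA, hfr⟩ := h.frame
  have hp : ∀ x ξ : Space d, packet α (0 : 𝓢(Space d, ℂ)) x ξ = 0 := fun x ξ => by
    unfold packet
    split_ifs <;> simp
  have hz : ((0 : 𝓢(Space d, ℂ)).toLp 2 : MeasureTheory.Lp ℂ 2 (MeasureTheory.volume)) = 0 :=
    map_zero (SchwartzMap.toLpCLM ℂ ℂ 2 MeasureTheory.volume)
  have h1 := (hfr (f.toLp 2)).2.1
  simp only [hp, hz, inner_zero_left, norm_zero, zero_pow two_ne_zero, tsum_zero] at h1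
  have h2 : ‖f.toLp 2 (MeasureTheory.volume : MeasureTheory.Measure (Space d))‖ ^ 2 ≤ 0 := by
    by_contra! hlt
    nlinarith [mul_pos hA hlt]
  have h3 : f.toLp 2 (MeasureTheory.volume : MeasureTheory.Measure (Space d)) = 0 := by
    have := sq_nonneg ‖f.toLp 2 (MeasureTheory.volume : MeasureTheory.Measure (Space d))‖
    exact norm_eq_zero.1 (pow_eq_zero_iff two_ne_zero |>.1 (le_antisymm h2 this))
  exact SchwartzMap.injective_toLp (F := ℂ) 2 (MeasureTheory.volume) (h3.trans hz.symm)

end SubdyadicGabor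

end

theorem proposition6p4 (d : ℕ) (α : ℝ) (hα : 0 < α)
    (φ₁ φ₂ : 𝓢(SubdyadicGabor.Space d, ℂ))
    (h₁ : SubdyadicGabor.IsAdmissibleWindow α φ₁)
    (h₂ : SubdyadicGabor.IsAdmissibleWindow α φ₂)
    (u : 𝓢'(SubdyadicGabor.Space d, ℂ)) :
    SubdyadicGabor.gaborWF α φ₁ u = SubdyadicGabor.gaborWF α φ₂ u := by
  -- If one window is zero, its lower frame bound forces every Schwartz function to vanish, so the
  -- other window is zero too.
  by_cases h₁0 : φ₁ = 0
  · subst h₁0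
    rw [h₁.eq_zero_of_zero φ₂]
  by_cases h₂0 : φ₂ = 0
  · subst h₂0
    rw [h₂.eq_zero_of_zero φ₁]
  ext p
  unfold SubdyadicGabor.gaborWF
  rw [Set.mem_ofPred_eq, Set.mem_ofPred_eq,
    SubdyadicGabor.isGaborRegularAt_iff_isMicrolocallyRegularAt hα h₁ h₁0,
    SubdyadicGabor.isGaborRegularAt_iff_isMicrolocallyRegularAt hα h₂ h₂0]
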